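/- All graphs are finite, simple and undirected. A \emph{coalition structure} over a graph $G=(N,E)$ is a partition of $N$ into non-empty coalitions; it is \emph{connected} if every coalition induces a connected subgraph of $G$. A function $v:2^N\to\mathbb R$ with $v(\emptyset)=0$ is \emph{independent of disconnected members} (IDM) if for all distinct non-adjacent $i,j\in N$ and all $C\subseteq N\setminus\{i,j\}$, $$v(C\cup\{i\})-v(C)=v(C\cup\{i,j\})-v(C\cup\{j\}).$$ The \emph{graph coalition structure generation} (GCSG) problem over a connected graph $G$ with IDM valuation $v$ is to find a connected coalition structure $\mathcal C$ over $G$ whose value $\sum_{C\in\mathcal C}v(C)$ is maximal among all coalition structures over $N$; the algorithm is given $G$ and may ask for the value $v(C)$ of any coalition $C$ in one step, and it may add, subtract and compare real numbers in one step each. Time is counted in elementary steps of a fixed uniform model of computation. A class $S$ of graphs \emph{satisfies an $f(n)$-separator theorem with constant $\alpha$} if for every $G\in S$ with $n$ nodes there are subgraphs $A,B\subseteq G$ with $A\cup B=G$ such that $A\cap B$ has at most $f(n)$ nodes and each of $A\setminus B$ and $B\setminus A$ has at most $\alpha n$ nodes. \textbf{Theorem.} Let $S$ be a class of graphs closed under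 taking subgraphs (and isomorphic copies), and let $g$ be a non-decreasing function such that every $n$-node graph in $S$ has at most $g(n)$ connected coalition structures. Let $f$ be a non-decreasing function with $f(n)=o(n)$, let $0<\alpha<1$, and suppose that $S$ satisfies an $f(n)$-separator theorem with constant $\alpha$ and that for every $G\in S$ such a separator can be found in $o(\exp(h(\alpha,n)))$ time, where $$h(\alpha,n)=\sum_{i=0}^{\lfloor \log n/|\log\alpha|\rfloor}\Bigl(2\log g\bigl(f(\alpha^i n)\bigr)+2f(\alpha^i n)\log\Bigl(\sum_{j=0}^{i-1}f(\alpha^j n)\Bigr)\Bigr),$$ and where for $i=0$ the inner sum, which has no terms, is to be read as $f(n)$ (so that the summand for $i=0$ is $2\log g(f(n))+2f(n)\log f(n)$). Then for every $\beta$ with $\alpha<\beta<1$ there is an algorithm that solves every instance of the GCSG problem over a graph of $S$ with $n$ nodes in $O(\exp(h(\beta,n)))$ computation steps. -/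

import Mathlib

namespace GCSG

/-! ### Machine model: a uniform first-order language over binary trees whose leaves may hold
natural numbers and real numbers; real numbers can only be added, subtracted and compared. -/

/-- Data: trees with natural-number and real-number leaves. -/
inductive Val : Type where
  | nil : Val
  | nat (k : ℕ) : Val
  | real (x : ℝ) : Val
  | pair (a b : Val) : Val

/-- Elementary operations. There are no real constants, so a program is a finite
combinatorial object. -/
inductive Op : Type where
  | mkNil | mkZero | fst | snd | isPair | succ
  | natAdd | natSub | natLt
  | realAdd | realSub | realLt

open Classical in
/-- The effect of an elementary operation (`none` if it does not apply to the argument).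
Truth values are the numbers `0` and `1`. -/
noncomputable def Op.eval : Op → Val → Option Val
  | .mkNil, _ => some .nil
  | .mkZero, _ => some (.nat 0)
  | .fst, .pair a _ => some a
  | .snd, .pair _ b => some b
  | .isPair, .pair _ _ => some (.nat 1)
  | .isPair, _ => some (.nat 0)
  | .succ, .nat k => some (.nat (k + 1))
  | .natAdd, .pair (.nat a) (.nat b) => some (.nat (a + b))
  | .natSub, .pair (.nat a) (.nat b) => some (.nat (a - b))
  | .natLt, .pair (.nat a) (.nat b) => some (.nat (if a < b then 1 else 0))
  | .realAdd, .pair (.real a) (.real b) => some (.real (a + b))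
  | .realSub, .pair (.real a) (.real b) => some (.real (a - b))
  | .realLt, .pair (.real a) (.real b) => some (.nat (if a < b then 1 else 0))
  | _, _ => none

/-- Programs. `seq p q` runs `p`, then `q` on its result; `fork p q` runs both on the same input
and pairs the results; `ite` branches; `loop c p` repeats `p` while the test `c` holds; `query`
asks the oracle for a real number; `fix p` runs `p` as a recursive procedure, and `call` is a
call of the innermost enclosing recursive procedure. -/
inductive Prog : Type where
  | skip : Prog
  | op (o : Op) : Prog
  | query : Prog
  | seq (p q : Prog) : Prog
  | fork (p q : Prog) : Prog
  | ite (c p q : Prog) : Prog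
  | loop (c p : Prog) : Prog
  | fix (p : Prog) : Prog
  | call : Prog

/-- `Run O s p x y t`: with oracle `O`, inside the recursive procedure with body `s`, the program
`p` started on `x` halts with result `y` after exactly `t` steps. An elementary operation, an
oracle query and each control construct cost one step. -/
inductive Run (O : Val → Option ℝ) : Prog → Prog → Val → Val → ℕ → Prop where
  | skip {s : Prog} {x : Val} : Run O s .skip x x 1
  | op {s : Prog} {o : Op} {x y : Val} (h : o.eval x = some y) : Run O s (.op o) x y 1
  | query {s : Prog} {x : Val} {r : ℝ} (h : O x = some r) : Run O s .query x (.real r) 1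
  | seq {s p q : Prog} {x y z : Val} {a b : ℕ}
      (hp : Run O s p x y a) (hq : Run O s q y z b) : Run O s (.seq p q) x z (a + b + 1)
  | fork {s p q : Prog} {x y z : Val} {a b : ℕ}
      (hp : Run O s p x y a) (hq : Run O s q x z b) :
      Run O s (.fork p q) x (.pair y z) (a + b + 1)
  | iteTrue {s c p q : Prog} {x y : Val} {k a b : ℕ}
      (hc : Run O s c x (.nat (k + 1)) a) (hp : Run O s p x y b) :
      Run O s (.ite c p q) x y (a + b + 1)
  | iteFalse {s c p q : Prog} {x y : Val} {a b : ℕ}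
      (hc : Run O s c x (.nat 0) a) (hq : Run O s q x y b) :
      Run O s (.ite c p q) x y (a + b + 1)
  | loopDone {s c p : Prog} {x : Val} {a : ℕ}
      (hc : Run O s c x (.nat 0) a) : Run O s (.loop c p) x x (a + 1)
  | loopStep {s c p : Prog} {x y z : Val} {k a b d : ℕ}
      (hc : Run O s c x (.nat (k + 1)) a) (hp : Run O s p x y b)
      (hl : Run O s (.loop c p) y z d) : Run O s (.loop c p) x z (a + b + d + 1)
  | fix {s p : Prog} {x y : Val} {a : ℕ}
      (h : Run O p p x y a) : Run O s (.fix p) x y (a + 1)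
  | call {s : Prog} {x y : Val} {a : ℕ}
      (h : Run O s s x y a) : Run O s .call x y (a + 1)

/-- The program `p`, with oracle `O` and input `x`, halts with result `y` after `t` steps. -/
def Exec (O : Val → Option ℝ) (p : Prog) (x y : Val) (t : ℕ) : Prop := Run O p p x y t

/-- The oracle that answers nothing: execution without oracle. -/
def noOracle : Val → Option ℝ := fun _ => none

/-! ### Encodings -/

/-- A list as a right-nested tree. -/
def Val.ofList : List Val → Val
  | [] => .nil
  | a :: l => .pair a (Val.ofList l)

open Classical in
/-- A graph with nodes `0, …, n - 1` is given by `n` and its adjacency matrix, row by row. -/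
noncomputable def encodeGraph {n : ℕ} (G : SimpleGraph (Fin n)) : Val :=
  .pair (.nat n) (Val.ofList ((List.finRange n).map fun i =>
    Val.ofList ((List.finRange n).map fun j => .nat (if G.Adj i j then 1 else 0))))

/-- The set of nodes described by a list of node numbers. -/
def decodeNodes (n : ℕ) : Val → Option (Finset (Fin n))
  | .nil => some ∅
  | .pair (.nat k) l =>
      if h : k < n then (decodeNodes n l).map (fun C => insert ⟨k, h⟩ C) else none
  | _ => none

/-- The family of node sets described by a list of lists of node numbers. -/
def decodeFamily (n : ℕ) : Val → Option (Finset (Finset (Fin n)))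
  | .nil => some ∅
  | .pair c l =>
      (decodeNodes n c).bind fun C => (decodeFamily n l).map fun F => insert C F
  | _ => none

/-- The value oracle: asked with a list of nodes, it returns the value of that coalition. -/
def valueOracle {n : ℕ} (v : Finset (Fin n) → ℝ) : Val → Option ℝ :=
  fun x => (decodeNodes n x).map v

/-! ### Coalition structures -/

/-- A coalition structure: a partition of the node set into non-empty coalitions. -/
abbrev CoalitionStructure (n : ℕ) : Type := Finpartition (Finset.univ : Finset (Fin n))

/-- Every coalition induces a connected subgraph. -/
def IsConnectedCS {n : ℕ} (G : SimpleGraph (Fin n)) (P : CoalitionStructure n) : Prop :=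
  ∀ C ∈ P.parts, (G.induce (C : Set (Fin n))).Connected

/-- The number of connected coalition structures of a graph. -/
noncomputable def numConnectedCS {n : ℕ} (G : SimpleGraph (Fin n)) : ℕ :=
  Nat.card {P : CoalitionStructure n // IsConnectedCS G P}

/-- The total value of a coalition structure. -/
def totalValue {n : ℕ} (v : Finset (Fin n) → ℝ) (P : CoalitionStructure n) : ℝ :=
  ∑ C ∈ P.parts, v C

/-- Independence of disconnected members: two distinct nodes `i`, `j` not joined by an edge (that
is, separated by `C` in the subgraph induced by `C ∪ {i, j}`) do not influence each other's
marginal contribution to `C`. -/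
def IsIDM {n : ℕ} (G : SimpleGraph (Fin n)) (v : Finset (Fin n) → ℝ) : Prop :=
  ∀ (i j : Fin n) (C : Finset (Fin n)), i ≠ j → ¬ G.Adj i j → i ∉ C → j ∉ C →
    v (insert i C) - v C = v (insert i (insert j C)) - v (insert j C)

/-- `P` solves the graph coalition structure generation problem: it is a connected coalition
structure, and its total value is maximal among all coalition structures. -/
def IsOptimalCS {n : ℕ} (G : SimpleGraph (Fin n)) (v : Finset (Fin n) → ℝ)
    (P : CoalitionStructure n) : Prop :=
  IsConnectedCS G P ∧ ∀ Q : CoalitionStructure n, totalValue v Q ≤ totalValue v P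

/-- The program `p`, with value oracle, solves the instance `(G, v)` in at most `T` steps. -/
def SolvesWithin {n : ℕ} (p : Prog) (G : SimpleGraph (Fin n)) (v : Finset (Fin n) → ℝ)
    (T : ℝ) : Prop :=
  ∃ (y : Val) (t : ℕ), Exec (valueOracle v) p (encodeGraph G) y t ∧ (t : ℝ) ≤ T ∧
    ∃ P : CoalitionStructure n, decodeFamily n y = some P.parts ∧ IsOptimalCS G v P

/-! ### Separators -/

/-- A class of finite graphs. -/
abbrev GraphClass : Type := (n : ℕ) → Set (SimpleGraph (Fin n))

/-- Closed under taking subgraphs (and hence under isomorphism). -/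
def GraphClass.SubgraphClosed (S : GraphClass) : Prop :=
  ∀ (m n : ℕ) (H : SimpleGraph (Fin m)) (G : SimpleGraph (Fin n)),
    G ∈ S n → H.IsContained G → H ∈ S m

/-- The subgraphs `A`, `B` cover `G`, share at most `f n` nodes, and each of them has at most
`α n` nodes outside the other one. -/
def IsSeparation (f : ℝ → ℝ) (α : ℝ) {n : ℕ} (G : SimpleGraph (Fin n)) (A B : G.Subgraph) :
    Prop :=
  A ⊔ B = ⊤ ∧ ((A.verts ∩ B.verts).ncard : ℝ) ≤ f n ∧
    ((A.verts \ B.verts).ncard : ℝ) ≤ α * n ∧ ((B.verts \ A.verts).ncard : ℝ) ≤ α * n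

/-- `S` satisfies an `f(n)`-separator theorem with constant `α`. -/
def GraphClass.SeparatorTheorem (S : GraphClass) (f : ℝ → ℝ) (α : ℝ) : Prop :=
  ∀ (n : ℕ) (G : SimpleGraph (Fin n)), G ∈ S n → ∃ A B : G.Subgraph, IsSeparation f α G A B

/-- Without oracle, the program `p` outputs the node sets of such a separation of `G` in at most
`T` steps. -/
def FindsSeparationWithin (p : Prog) (f : ℝ → ℝ) (α : ℝ) {n : ℕ} (G : SimpleGraph (Fin n))
    (T : ℝ) : Prop :=
  ∃ (y z : Val) (t : ℕ), Exec noOracle p (encodeGraph G) (.pair y z) t ∧ (t : ℝ) ≤ T ∧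
    ∃ (A B : G.Subgraph) (U W : Finset (Fin n)), IsSeparation f α G A B ∧
      decodeNodes n y = some U ∧ (U : Set (Fin n)) = A.verts ∧
      decodeNodes n z = some W ∧ (W : Set (Fin n)) = B.verts

/-- The exponent `h(α, n)`. For `i = 0`, where the inner sum would be empty and its logarithm
undefined, the inner sum is read as `f(n)`. -/
noncomputable def h (f g : ℝ → ℝ) (α : ℝ) (n : ℕ) : ℝ :=
  ∑ i ∈ Finset.range (⌊Real.log n / |Real.log α|⌋₊ + 1),
    (2 * Real.log (g (f (α ^ i * n))) +
      2 * f (α ^ i * n) *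
        Real.log (if i = 0 then f n else ∑ j ∈ Finset.range i, f (α ^ j * n)))

end GCSG

/-! The algorithm is divide and conquer on labellings: a coalition structure is a labelling of the
nodes up to renaming of labels. Suppose the nodes in D, those of the current separator and of all
separators above it, carry labels, and let A, B be the two sides. Under any labelling, IDM applied
block by block gives value(D ∪ A ∪ B) + value(D) = value(D ∪ A) + value(D ∪ B) (`labelValue_union`),
so that the sides can be optimised independently (`OptExt.append`). Giving each separator node every
old label and one new label misses no partition (`OptExt.cons`). The search ranges over all
partitions, connected or not. At the end the blocks are split into connected components, which by
IDM and v(∅) = 0 leaves the total value unchanged (`labelValue_refine`, `exists_isOptimalCS`).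

Running time: at depth i the sides have at most α^i n nodes and k ≤ ∑_{j<i} f(α^j n) nodes are
labelled. A separator of r ≤ f(α^i n) nodes then leads to (k+1)⋯(k+r) branches, at most twice the
exponential of the i-th summand of h (`Admissible.ascFactorial_le`). Separating a side of m nodes
takes O(exp h(α, m)), and for m ≥ 1 this exponent is at most the sum of the summands of h(α, n) from
the i-th on (`Admissible.h_le_sum_Ico`). The recurrence solves to exp h(α, n) times a polynomial
times a constant raised to the number of levels (`exists_runs_searchP`). There are O(log n) levels,
so the overhead is a power n^c up to a constant.

Passing from α to β absorbs this power: h(β, n) has more summands than h(α, n) by a constant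
multiple of log n, and each extra one is at least twice the logarithm of the number of levels for α.
Hence h(β, n) exceeds h(α, n) + c log n up to a constant (`Admissible.exists_h_add_le`).

The remainder realises the algorithm in the machine model. Programs act on an environment of nested
pairs, and their times are bounded by `cost`, a family of bounds stable under composition and loops.
-/

namespace GCSG

/-! ### Running time bounds -/

/-- `p`, started on `x`, halts with result `y` after at most `T` steps. -/
def RunsIn (O : Val → Option ℝ) (s p : Prog) (x y : Val) (T : ℕ) : Prop :=
  ∃ t ≤ T, Run O s p x y t

/-- A time bound polynomial in `M`, with leading factor `b + 1`. -/
@[irreducible] def cost (b M c : ℕ) : ℕ := (b + 1) * (M + 2) ^ c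

/-- Halting within a polynomial time bound. -/
def Runs (O : Val → Option ℝ) (s : Prog) (b M c : ℕ) (p : Prog) (x y : Val) : Prop :=
  RunsIn O s p x y (cost b M c)

theorem cost_mono (b M : ℕ) {c d : ℕ} (h : c ≤ d) : cost b M c ≤ cost b M d := by
  unfold cost
  exact Nat.mul_le_mul_left _ (Nat.pow_le_pow_right (by omega) h)

theorem two_pow_le_cost (b M c : ℕ) : 2 ^ c ≤ cost b M c := by
  unfold cost
  calc 2 ^ c ≤ (M + 2) ^ c := Nat.pow_le_pow_left (by omega) c
    _ ≤ (b + 1) * (M + 2) ^ c := Nat.le_mul_of_pos_left _ (by omega)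

/-- Since M + 2 ≥ 2, a larger exponent pays for constant factors. All bookkeeping constants below
are absorbed in this way. -/
theorem two_pow_mul_cost_le (b M c k : ℕ) : 2 ^ k * cost b M c ≤ cost b M (c + k) := by
  unfold cost
  rw [pow_add]
  calc 2 ^ k * ((b + 1) * (M + 2) ^ c) = (b + 1) * ((M + 2) ^ c * 2 ^ k) := by ring
    _ ≤ _ := Nat.mul_le_mul_left _ (Nat.mul_le_mul_left _ (Nat.pow_le_pow_left (by omega) k))

theorem two_pow_mul_cost_le_of (b M : ℕ) {c k d : ℕ} (h : c + k ≤ d) :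
    2 ^ k * cost b M c ≤ cost b M d :=
  (two_pow_mul_cost_le b M c k).trans (cost_mono b M h)

/-- One of the two factors has b = 0: the time stays linear in b + 1, which later stands for the
running time of the separation program. -/
theorem cost_mul_cost_zero (b M c d : ℕ) : cost b M c * cost 0 M d = cost b M (c + d) := by
  unfold cost
  rw [pow_add]
  ring

theorem cost_zero_le (b M c : ℕ) : cost 0 M c ≤ cost b M c := by
  unfold cost
  exact Nat.mul_le_mul_right _ (by omega)

section

variable {O : Val → Option ℝ} {s p q c l i e : Prog} {x y z : Val} {a b d T M : ℕ}

theorem RunsIn.mono (h : RunsIn O s p x y a) (hab : a ≤ b) : RunsIn O s p x y b := by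
  obtain ⟨t, ht, hr⟩ := h
  exact ⟨t, ht.trans hab, hr⟩

theorem RunsIn.seq (hp : RunsIn O s p x y a) (hq : RunsIn O s q y z b) :
    RunsIn O s (.seq p q) x z (a + b + 1) := by
  obtain ⟨t, ht, hr⟩ := hp
  obtain ⟨t', ht', hr'⟩ := hq
  exact ⟨_, by omega, .seq hr hr'⟩

theorem RunsIn.fork (hp : RunsIn O s p x y a) (hq : RunsIn O s q x z b) :
    RunsIn O s (.fork p q) x (.pair y z) (a + b + 1) := by
  obtain ⟨t, ht, hr⟩ := hp
  obtain ⟨t', ht', hr'⟩ := hq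
  exact ⟨_, by omega, .fork hr hr'⟩

theorem RunsIn.ite {P : Prop} [Decidable P]
    (hc : RunsIn O s c x (.nat (if P then 1 else 0)) a)
    (hp : P → RunsIn O s p x y b) (hq : ¬ P → RunsIn O s q x y b) :
    RunsIn O s (.ite c p q) x y (a + b + 1) := by
  obtain ⟨t, ht, hr⟩ := hc
  by_cases h : P
  · rw [if_pos h] at hr
    obtain ⟨t', ht', hr'⟩ := hp h
    exact ⟨_, by omega, .iteTrue hr hr'⟩
  · rw [if_neg h] at hr
    obtain ⟨t', ht', hr'⟩ := hq h
    exact ⟨_, by omega, .iteFalse hr hr'⟩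

theorem RunsIn.op {o : Op} (h : o.eval x = some y) : RunsIn O s (.op o) x y 1 :=
  ⟨1, le_rfl, .op h⟩

theorem RunsIn.skip : RunsIn O s .skip x x 1 := ⟨1, le_rfl, .skip⟩

theorem RunsIn.query {r : ℝ} (h : O x = some r) : RunsIn O s .query x (.real r) 1 :=
  ⟨1, le_rfl, .query h⟩

theorem RunsIn.call (h : RunsIn O s s x y a) : RunsIn O s .call x y (a + 1) := by
  obtain ⟨t, ht, hr⟩ := h
  exact ⟨_, by omega, .call hr⟩

theorem RunsIn.fix (h : RunsIn O p p x y a) : RunsIn O s (.fix p) x y (a + 1) := by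
  obtain ⟨t, ht, hr⟩ := h
  exact ⟨_, by omega, .fix hr⟩

/-- Fold over the list computed by `l`, starting with the result of `i`; the body `e` sees the
current element, the accumulator and the input. -/
def foldP (l i e : Prog) : Prog :=
  .seq (.fork l (.fork i .skip))
    (.seq
      (.loop (.seq (.op .fst) (.op .isPair))
        (.fork (.seq (.op .fst) (.op .snd))
          (.fork (.seq (.fork (.seq (.op .fst) (.op .fst)) (.op .snd)) e)
            (.seq (.op .snd) (.op .snd)))))
      (.seq (.op .snd) (.op .fst)))

/-- The loop state is the unprocessed suffix, the accumulator and the untouched input; the invariant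
`I` speaks of the processed prefix. -/
theorem RunsIn.foldLoop {α : Type} {enc : α → Val} {L : List α} (I : List α → Val → Prop)
    (hb : ∀ pre a suf g, L = pre ++ a :: suf → I pre g →
      ∃ g', RunsIn O s e (.pair (enc a) (.pair g x)) g' T ∧ I (pre ++ [a]) g') :
    ∀ (suf pre : List α) (g : Val), L = pre ++ suf → I pre g →
      ∃ g', RunsIn O s (.loop (.seq (.op .fst) (.op .isPair))
        (.fork (.seq (.op .fst) (.op .snd))
          (.fork (.seq (.fork (.seq (.op .fst) (.op .fst)) (.op .snd)) e)
            (.seq (.op .snd) (.op .snd)))))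
        (.pair (Val.ofList (suf.map enc)) (.pair g x)) (.pair .nil (.pair g' x))
        (suf.length * (T + 30) + 10) ∧ I L g' := by
  intro suf
  induction suf with
  | nil =>
    intro pre g hL hI
    refine ⟨g, ⟨3 + 1, by omega, .loopDone ?_⟩, by simpa [hL] using hI⟩
    exact .seq (y := .nil) (a := 1) (b := 1) (.op rfl) (.op rfl)
  | cons a suf ih =>
    intro pre g hL hI
    obtain ⟨g', ⟨t, ht, hr⟩, hI'⟩ := hb pre a suf g hL hI
    obtain ⟨g'', ⟨t', ht', hr'⟩, hI''⟩ := ih (pre ++ [a]) g' (by simp [hL]) hI'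
    have hc : Run O s (.seq (.op .fst) (.op .isPair))
        (.pair (Val.ofList ((a :: suf).map enc)) (.pair g x)) (.nat (0 + 1)) (1 + 1 + 1) :=
      .seq (.op rfl) (.op rfl)
    have hbody : Run O s (.fork (.seq (.op .fst) (.op .snd))
          (.fork (.seq (.fork (.seq (.op .fst) (.op .fst)) (.op .snd)) e)
            (.seq (.op .snd) (.op .snd))))
        (.pair (Val.ofList ((a :: suf).map enc)) (.pair g x))
        (.pair (Val.ofList (suf.map enc)) (.pair g' x)) _ :=
      .fork (.seq (.op rfl) (.op rfl))
        (.fork (.seq (.fork (.seq (.op rfl) (.op rfl)) (.op rfl)) hr)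
          (.seq (.op rfl) (.op rfl)))
    refine ⟨g'', ⟨_, ?_, .loopStep hc hbody hr'⟩, hI''⟩
    simp only [List.length_cons, add_mul]
    omega

theorem RunsIn.fold {α : Type} {enc : α → Val} {L : List α} {g₀ : Val} (I : List α → Val → Prop)
    (hl : RunsIn O s l x (Val.ofList (L.map enc)) a) (hi : RunsIn O s i x g₀ b) (h0 : I [] g₀)
    (hb : ∀ pre a suf g, L = pre ++ a :: suf → I pre g →
      ∃ g', RunsIn O s e (.pair (enc a) (.pair g x)) g' T ∧ I (pre ++ [a]) g') :
    ∃ g, RunsIn O s (foldP l i e) x g (a + b + L.length * (T + 30) + 30) ∧ I L g := by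
  obtain ⟨g, hg, hI⟩ := RunsIn.foldLoop I hb L [] g₀ rfl h0
  refine ⟨g, ?_, hI⟩
  refine ((hl.fork (hi.fork .skip)).seq (hg.seq ((RunsIn.op rfl).seq (.op rfl)))).mono ?_
  omega

/-! ### Polynomial time bounds -/

theorem Runs.mono (h : Runs O s b M a p x y) (hab : a ≤ d) : Runs O s b M d p x y :=
  RunsIn.mono h (cost_mono b M hab)

theorem RunsIn.runs {k : ℕ} (h : RunsIn O s p x y a) (ha : a ≤ 2 ^ k) : Runs O s b M k p x y :=
  RunsIn.mono h (ha.trans (two_pow_le_cost b M k))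

theorem cost_add_cost_succ_le (b M a d : ℕ) :
    cost b M a + cost b M d + 1 ≤ cost b M (max a d + 2) := by
  have h1 := cost_mono b M (le_max_left a d)
  have h2 := cost_mono b M (le_max_right a d)
  have h3 := two_pow_mul_cost_le b M (max a d) 2
  have h4 := two_pow_le_cost b M (max a d)
  have h5 : 1 ≤ 2 ^ (max a d) := Nat.one_le_two_pow
  omega

theorem Runs.seq (hp : Runs O s b M a p x y) (hq : Runs O s b M d q y z) :
    Runs O s b M (max a d + 2) (.seq p q) x z :=
  (RunsIn.seq hp hq).mono (cost_add_cost_succ_le ..)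

theorem Runs.fork (hp : Runs O s b M a p x y) (hq : Runs O s b M d q x z) :
    Runs O s b M (max a d + 2) (.fork p q) x (.pair y z) :=
  (RunsIn.fork hp hq).mono (cost_add_cost_succ_le ..)

theorem Runs.ite {P : Prop} [Decidable P]
    (hc : Runs O s b M a c x (.nat (if P then 1 else 0)))
    (hp : P → Runs O s b M d p x y) (hq : ¬ P → Runs O s b M d q x y) :
    Runs O s b M (max a d + 2) (.ite c p q) x y :=
  (RunsIn.ite hc hp hq).mono (cost_add_cost_succ_le ..)

theorem Runs.op {o : Op} (h : o.eval x = some y) : Runs O s b M 0 (.op o) x y :=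
  (RunsIn.op h).runs le_rfl

theorem Runs.skip : Runs O s b M 0 .skip x x := RunsIn.skip.runs le_rfl

theorem Runs.query {r : ℝ} (h : O x = some r) : Runs O s b M 0 .query x (.real r) :=
  (RunsIn.query h).runs le_rfl

theorem cost_fold_le (b M a d f : ℕ) {n k : ℕ} (hn : n ≤ cost 0 M k) :
    cost b M a + cost b M d + n * (cost b M f + 30) + 30 ≤
      cost b M (max a (max d (f + k)) + 10) := by
  set m := max a (max d (f + k)) with hm
  have h1 : cost b M a ≤ cost b M m := cost_mono b M (by omega)
  have h2 : cost b M d ≤ cost b M m := cost_mono b M (by omega)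
  have h3 := two_pow_mul_cost_le b M m 10
  have h4 := two_pow_le_cost b M m
  have h5 : 1 ≤ 2 ^ m := Nat.one_le_two_pow
  have h6 : n * (cost b M f + 30) ≤ 31 * cost b M m := by
    have h7 : 1 ≤ cost b M f := Nat.one_le_two_pow.trans (two_pow_le_cost b M f)
    calc n * (cost b M f + 30) ≤ cost 0 M k * (31 * cost b M f) :=
          Nat.mul_le_mul hn (by omega)
      _ = 31 * (cost b M f * cost 0 M k) := by ring
      _ = 31 * cost b M (f + k) := by rw [cost_mul_cost_zero]
      _ ≤ 31 * cost b M m := Nat.mul_le_mul_left _ (cost_mono b M (by omega))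
  omega

/-- Here the list instead of the body carries the factor b + 1. This serves for lists written by the
separation program, whose length is controlled only through its running time. -/
theorem cost_fold_le' (b M a d f : ℕ) {n k : ℕ} (hn : n ≤ cost b M k) :
    cost b M a + cost b M d + n * (cost 0 M f + 30) + 30 ≤
      cost b M (max a (max d (f + k)) + 10) := by
  set m := max a (max d (f + k)) with hm
  have h1 : cost b M a ≤ cost b M m := cost_mono b M (by omega)
  have h2 : cost b M d ≤ cost b M m := cost_mono b M (by omega)
  have h3 := two_pow_mul_cost_le b M m 10
  have h4 := two_pow_le_cost b M m
  have h5 : 1 ≤ 2 ^ m := Nat.one_le_two_pow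
  have h6 : n * (cost 0 M f + 30) ≤ 31 * cost b M m := by
    have h7 : 1 ≤ cost 0 M f := Nat.one_le_two_pow.trans (two_pow_le_cost 0 M f)
    calc n * (cost 0 M f + 30) ≤ cost b M k * (31 * cost 0 M f) :=
          Nat.mul_le_mul hn (by omega)
      _ = 31 * (cost b M k * cost 0 M f) := by ring
      _ = 31 * cost b M (k + f) := by rw [cost_mul_cost_zero]
      _ ≤ 31 * cost b M m := Nat.mul_le_mul_left _ (cost_mono b M (by omega))
  omega

theorem le_cost_one {n : ℕ} (h : n ≤ M) : n ≤ cost b M 1 := by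
  unfold cost
  nlinarith [Nat.zero_le (b * M)]

theorem Runs.fold {α : Type} {enc : α → Val} {L : List α} {g₀ : Val} {f : ℕ}
    (I : List α → Val → Prop) (hlen : L.length ≤ M)
    (hl : Runs O s b M a l x (Val.ofList (L.map enc))) (hi : Runs O s b M d i x g₀) (h0 : I [] g₀)
    (hb : ∀ pre a suf g, L = pre ++ a :: suf → I pre g →
      ∃ g', Runs O s b M f e (.pair (enc a) (.pair g x)) g' ∧ I (pre ++ [a]) g') :
    ∃ g, Runs O s b M (max a (max d (f + 1)) + 10) (foldP l i e) x g ∧ I L g := by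
  obtain ⟨g, hg, hI⟩ := RunsIn.fold I hl hi h0 hb
  exact ⟨g, hg.mono (cost_fold_le _ _ _ _ _ (le_cost_one hlen)), hI⟩

/-! ### Basic programs -/

/-- Entry number `k` of an environment. -/
def var : ℕ → Prog
  | 0 => .op .fst
  | k + 1 => .seq (.op .snd) (var k)

/-- The result of `p`, pushed onto the environment, is available to `q`. -/
def letP (p q : Prog) : Prog := .seq (.fork p .skip) q

/-- Elementary operation applied to the results of two programs. -/
def op2 (o : Op) (p q : Prog) : Prog := .seq (.fork p q) (.op o)

/-- Run `p` on the environment without its first two entries. -/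
def lift2 (p : Prog) : Prog := .seq (.seq (.op .snd) (.op .snd)) p

/-- The number zero. -/
def zeroP : Prog := .op .mkZero

/-- The number one. -/
def oneP : Prog := .seq (.op .mkZero) (.op .succ)

/-- The empty list. -/
def nilP : Prog := .op .mkNil

/-- First component. -/
def fstP (p : Prog) : Prog := .seq p (.op .fst)

/-- Second component. -/
def sndP (p : Prog) : Prog := .seq p (.op .snd)

theorem runs_var_zero {u r : Val} : Runs O s b M 0 (var 0) (.pair u r) u := .op rfl

theorem Runs.push {u : Val} {k : ℕ} (h : Runs O s b M a (var k) x y) :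
    Runs O s b M (a + 2) (var (k + 1)) (.pair u x) y :=
  ((Runs.op (o := .snd) rfl).seq h).mono (by omega)

theorem runs_var1 {u u1 r : Val} : Runs O s b M 2 (var 1) (.pair u (.pair u1 r)) u1 :=
  runs_var_zero.push

theorem runs_var2 {u u1 u2 r : Val} :
    Runs O s b M 4 (var 2) (.pair u (.pair u1 (.pair u2 r))) u2 :=
  runs_var1.push

theorem runs_var3 {u u1 u2 u3 r : Val} :
    Runs O s b M 6 (var 3) (.pair u (.pair u1 (.pair u2 (.pair u3 r)))) u3 :=
  runs_var2.push

theorem runs_var4 {u u1 u2 u3 u4 r : Val} :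
    Runs O s b M 8 (var 4) (.pair u (.pair u1 (.pair u2 (.pair u3 (.pair u4 r))))) u4 :=
  runs_var3.push

theorem runs_var5 {u u1 u2 u3 u4 u5 r : Val} :
    Runs O s b M 10 (var 5)
      (.pair u (.pair u1 (.pair u2 (.pair u3 (.pair u4 (.pair u5 r)))))) u5 :=
  runs_var4.push

theorem runs_var6 {u u1 u2 u3 u4 u5 u6 r : Val} :
    Runs O s b M 12 (var 6)
      (.pair u (.pair u1 (.pair u2 (.pair u3 (.pair u4 (.pair u5 (.pair u6 r))))))) u6 :=
  runs_var5.push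

theorem Runs.letP (hp : Runs O s b M a p x y) (hq : Runs O s b M d q (.pair y x) z) :
    Runs O s b M (max a d + 4) (letP p q) x z :=
  ((hp.fork .skip).seq hq).mono (by omega)

theorem Runs.op2 {o : Op} {w : Val} (hp : Runs O s b M a p x y) (hq : Runs O s b M d q x z)
    (h : o.eval (.pair y z) = some w) : Runs O s b M (max a d + 4) (op2 o p q) x w :=
  ((hp.fork hq).seq (.op h)).mono (by omega)

theorem Runs.lift2 {u u' : Val} (h : Runs O s b M a p x y) :
    Runs O s b M (a + 4) (lift2 p) (.pair u (.pair u' x)) y :=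
  (((Runs.op rfl).seq (.op rfl)).seq h).mono (by omega)

theorem runs_zeroP : Runs O s b M 0 zeroP x (.nat 0) := .op rfl

theorem runs_oneP : Runs O s b M 2 oneP x (.nat 1) := (Runs.op rfl).seq (.op rfl)

theorem runs_nilP : Runs O s b M 0 nilP x .nil := .op rfl

theorem Runs.fstP (h : Runs O s b M a p x (.pair y z)) : Runs O s b M (a + 2) (fstP p) x y :=
  (h.seq (.op rfl)).mono (by omega)

theorem Runs.sndP (h : Runs O s b M a p x (.pair y z)) : Runs O s b M (a + 2) (sndP p) x z :=
  (h.seq (.op rfl)).mono (by omega)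

/-- Equality test of numbers. -/
def eqP (p q : Prog) : Prog :=
  .ite (op2 .natLt p q) zeroP (.ite (op2 .natLt q p) zeroP oneP)

theorem Runs.eqP {m n : ℕ} (hp : Runs O s b M a p x (.nat m)) (hq : Runs O s b M d q x (.nat n)) :
    Runs O s b M (max a d + 8) (eqP p q) x (.nat (if m = n then 1 else 0)) := by
  refine (Runs.ite (P := m < n) (hp.op2 hq rfl) (fun h => ?_) (fun h =>
    Runs.ite (P := n < m) (y := .nat (if m = n then 1 else 0)) (d := 2)
      (hq.op2 hp rfl) (fun h' => ?_) (fun h' => ?_))).mono ?_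
  · rw [if_neg (by omega)]
    exact runs_zeroP.mono (by omega)
  · rw [if_neg (by omega)]
    exact runs_zeroP.mono (by omega)
  · rw [if_pos (by omega)]
    exact runs_oneP
  · omega

/-- Membership of the result of `k` in the list of numbers computed by `l`. -/
def memP (k l : Prog) : Prog :=
  foldP l zeroP (.ite (eqP (var 0) (lift2 k)) oneP (var 1))

theorem Runs.memP {m : ℕ} {L : List ℕ} {k : ℕ} (hlen : L.length ≤ cost b M k)
    (hk : Runs O s 0 M a p x (.nat m))
    (hl : Runs O s b M d l x (Val.ofList (L.map Val.nat))) :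
    Runs O s b M (max a d + k + 24) (memP p l) x (.nat (if m ∈ L then 1 else 0)) := by
  obtain ⟨g, hg, rfl⟩ := RunsIn.fold (i := zeroP) (T := cost 0 M (a + 14))
    (e := .ite (GCSG.eqP (var 0) (GCSG.lift2 p)) oneP (var 1))
    (fun pre g => g = .nat (if m ∈ pre then 1 else 0)) hl (Runs.op (b := b) (M := M) rfl) (by simp)
    (by
      rintro pre u suf _ hL rfl
      refine ⟨_, ?_, rfl⟩
      refine Runs.mono (Runs.ite (P := u = m) (runs_var_zero.eqP hk.lift2)
        (fun h => ?_) (fun h => ?_) (d := 2)) (by omega)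
      · simpa [h] using runs_oneP
      · simpa [Ne.symm h, eq_comm, h] using runs_var1)
  exact hg.mono ((cost_fold_le' _ _ _ _ _ hlen).trans (cost_mono _ _ (by omega)))

/-- From the list computed by `l`, collect the values of `e` at the elements that pass the test
`c`, in reverse order. -/
def selP (l c e : Prog) : Prog :=
  foldP l nilP (.ite c (.fork e (var 1)) (var 1))

theorem Runs.selP {α : Type} {enc : α → Val} {L : List α} {f : ℕ} (t : α → Prop)
    [DecidablePred t] (F : α → Val) (hlen : L.length ≤ M)
    (hl : Runs O s b M a l x (Val.ofList (L.map enc)))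
    (hc : ∀ u ∈ L, ∀ r, Runs O s b M d c (.pair (enc u) (.pair r x))
      (.nat (if t u then 1 else 0)))
    (he : ∀ u ∈ L, t u → ∀ r, Runs O s b M f e (.pair (enc u) (.pair r x)) (F u)) :
    Runs O s b M (max a (max d f) + 20) (selP l c e) x
      (Val.ofList (((L.filter t).map F).reverse)) := by
  obtain ⟨g, hg, rfl⟩ := Runs.fold (i := nilP) (d := 0) (f := max d (max f 2 + 2) + 2)
    (e := .ite c (.fork e (var 1)) (var 1))
    (fun pre g => g = Val.ofList (((pre.filter t).map F).reverse)) hlen hl runs_nilP rfl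
    (by
      rintro pre u suf _ hL rfl
      have hu : u ∈ L := by simp [hL]
      refine ⟨_, Runs.ite (P := t u) (hc u hu _) (fun h => ?_) (fun h => ?_), rfl⟩
      · simpa [h, Val.ofList] using (he u hu h _).fork runs_var1
      · simpa [h] using runs_var1.mono (by omega))
  exact hg.mono (by omega)

/-- The values of `e` on the list computed by `l`, in reverse order. -/
def mapP (l e : Prog) : Prog := selP l oneP e

theorem Runs.mapP {α : Type} {enc : α → Val} {L : List α} (F : α → Val) (hlen : L.length ≤ M)
    (hl : Runs O s b M a l x (Val.ofList (L.map enc)))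
    (he : ∀ u ∈ L, ∀ r, Runs O s b M d e (.pair (enc u) (.pair r x)) (F u)) :
    Runs O s b M (max a d + 22) (mapP l e) x (Val.ofList ((L.map F).reverse)) := by
  have := Runs.selP (c := oneP) (d := 2) (fun _ => True) F hlen hl
    (fun u _ r => by simpa using runs_oneP) (fun u hu _ => he u hu)
  simp only [decide_true, List.filter_true] at this
  exact this.mono (by omega)

/-- The elements of the first list, in reverse order, followed by the second list. -/
def appP (p q : Prog) : Prog := foldP p q (.fork (var 0) (var 1))

theorem Runs.appP {L L' : List Val} (hlen : L.length ≤ M)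
    (hp : Runs O s b M a p x (Val.ofList L)) (hq : Runs O s b M d q x (Val.ofList L')) :
    Runs O s b M (max a d + 15) (appP p q) x (Val.ofList (L.reverse ++ L')) := by
  obtain ⟨g, hg, rfl⟩ := Runs.fold (e := .fork (var 0) (var 1)) (f := 4) (enc := id)
    (fun pre g => g = Val.ofList (pre.reverse ++ L')) hlen (by simpa using hp) hq rfl
    (by
      rintro pre u suf _ hL rfl
      exact ⟨_, runs_var_zero.fork runs_var1, by simp [Val.ofList]⟩)
  exact hg.mono (by omega)

/-- The length of a list. -/
def countP (l : Prog) : Prog := foldP l zeroP (.seq (var 1) (.op .succ))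

theorem Runs.countP {L : List Val} (hlen : L.length ≤ M)
    (hl : Runs O s b M a l x (Val.ofList L)) :
    Runs O s b M (a + 20) (countP l) x (.nat L.length) := by
  obtain ⟨g, hg, rfl⟩ := Runs.fold (e := .seq (var 1) (.op .succ)) (enc := id)
    (fun pre g => g = .nat pre.length) hlen (by simpa using hl) (runs_zeroP) rfl
    (by
      rintro pre u suf _ hL rfl
      exact ⟨_, runs_var1.seq (.op rfl), by simp⟩)
  exact hg.mono (by omega)

/-- Entry number `p` of the list `l`. -/
def nthP (p l : Prog) : Prog :=
  .seq (.fork p l)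
    (.seq (.loop (.op .fst) (.fork (op2 .natSub (.op .fst) oneP) (sndP (.op .snd))))
      (fstP (.op .snd)))

theorem Runs.nthP {L : List Val} {k : ℕ} {u : Val} (hk : k ≤ M) (hu : L[k]? = some u)
    (hp : Runs O s b M a p x (.nat k)) (hl : Runs O s b M d l x (Val.ofList L)) :
    Runs O s b M (max a d + 12) (nthP p l) x u := by
  have key : ∀ (k : ℕ) (L : List Val), L[k]? = some u →
      ∃ r, RunsIn O s (.loop (.op .fst) (.fork (GCSG.op2 .natSub (.op .fst) oneP)
        (GCSG.sndP (.op .snd)))) (.pair (.nat k) (Val.ofList L)) (.pair (.nat 0) (.pair u r))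
        (k * 20 + 2) := by
    intro k
    induction k with
    | zero =>
      intro L hL
      cases L with
      | nil => simp at hL
      | cons w L =>
        simp only [List.getElem?_cons_zero, Option.some.injEq] at hL
        subst hL
        exact ⟨_, 2, le_rfl, .loopDone (.op rfl)⟩
    | succ k ih =>
      intro L hL
      cases L with
      | nil => simp at hL
      | cons w L =>
        obtain ⟨r, t, ht, hr⟩ := ih L (by simpa using hL)
        refine ⟨r, _, ?_, .loopStep (.op rfl)
          (.fork (.seq (.fork (.op rfl) (.seq (.op rfl) (.op rfl))) (.op rfl))
            (.seq (.op rfl) (.op rfl))) hr⟩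
        omega
  obtain ⟨r, hr⟩ := key k L hu
  refine ((RunsIn.fork hp hl).seq (hr.seq ((RunsIn.op rfl).seq (.op rfl)))).mono ?_
  have h1 := cost_mono b M (le_max_left a d)
  have h2 := cost_mono b M (le_max_right a d)
  have h3 := two_pow_mul_cost_le b M (max a d) 11
  have h4 : 2 ^ 11 * cost b M (max a d) ≤ cost b M (max a d + 12) :=
    h3.trans (cost_mono _ _ (by omega))
  have h5 : k ≤ cost b M (max a d + 1) := (le_cost_one hk).trans (cost_mono _ _ (by omega))
  have h6 := two_pow_mul_cost_le b M (max a d + 1) 11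
  have h7 : 1 ≤ 2 ^ (max a d) := Nat.one_le_two_pow
  have h8 := two_pow_le_cost b M (max a d)
  have h9 : cost b M (max a d) ≤ cost b M (max a d + 1) := cost_mono _ _ (by omega)
  have h10 : max a d + 1 + 11 = max a d + 12 := rfl
  rw [h10] at h6
  omega

/-- Entry `(p, q)` of the matrix `r`. -/
def entryP (r p q : Prog) : Prog := nthP q (nthP p r)

/-- A query to `noOracle` never succeeds, so a halting run contains none. The separation program can
therefore be used as a subroutine of a program with oracle. -/
theorem Run.of_noOracle {t : ℕ} (h : Run noOracle s p x y t) : Run O s p x y t := by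
  induction h with
  | skip => exact .skip
  | op h => exact .op h
  | query h => simp [noOracle] at h
  | seq _ _ ih1 ih2 => exact .seq ih1 ih2
  | fork _ _ ih1 ih2 => exact .fork ih1 ih2
  | iteTrue _ _ ih1 ih2 => exact .iteTrue ih1 ih2
  | iteFalse _ _ ih1 ih2 => exact .iteFalse ih1 ih2
  | loopDone _ ih1 => exact .loopDone ih1
  | loopStep _ _ _ ih1 ih2 ih3 => exact .loopStep ih1 ih2 ih3
  | fix _ ih => exact .fix ih
  | call _ ih => exact .call ih

/-! ### Results are not much higher than inputs -/

/-- The height of a tree. -/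
def Val.height : Val → ℕ
  | .nil => 0
  | .nat _ => 0
  | .real _ => 0
  | .pair a b => max a.height b.height + 1

theorem Op.height_le {o : Op} (h : o.eval x = some y) : y.height ≤ x.height := by
  cases o <;> unfold Op.eval at h <;> split at h <;> cases h <;> simp [Val.height] <;>
    omega

/-- Only `fork` creates height, one unit for its own step. As a list is no longer than its height,
this bounds the length of lists that the separation program outputs. -/
theorem Run.height_le {t : ℕ} (h : Run O s p x y t) : y.height ≤ x.height + t := by
  induction h with
  | skip => omega
  | op h => have := Op.height_le h; omega
  | query h => simp [Val.height]
  | fork _ _ ih1 ih2 => simp only [Val.height]; omega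
  | _ => omega

theorem Val.length_le_height (L : List Val) : L.length ≤ (Val.ofList L).height := by
  induction L with
  | nil => simp
  | cons a L ih => simp only [Val.ofList, Val.height, List.length_cons]; omega

theorem Val.height_ofList_le {L : List Val} {k : ℕ} (h : ∀ a ∈ L, a.height ≤ k) :
    (Val.ofList L).height ≤ k + L.length := by
  induction L with
  | nil => simp [Val.ofList, Val.height]
  | cons a L ih =>
    have h1 := h a (by simp)
    have h2 := ih fun b hb => h b (by simp [hb])
    simp only [Val.ofList, Val.height, List.length_cons]
    omega

theorem height_encodeGraph_le {n : ℕ} (G : SimpleGraph (Fin n)) :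
    (encodeGraph G).height ≤ 2 * n + 1 := by
  have h : ∀ i : Fin n, (Val.ofList ((List.finRange n).map fun j =>
      open Classical in Val.nat (if G.Adj i j then 1 else 0))).height ≤ 0 + n := by
    intro i
    refine (Val.height_ofList_le (k := 0) ?_).trans (by simp)
    intro a ha
    obtain ⟨j, -, rfl⟩ := List.mem_map.1 ha
    simp [Val.height]
  have h' : (Val.ofList ((List.finRange n).map fun i =>
      Val.ofList ((List.finRange n).map fun j =>
        open Classical in Val.nat (if G.Adj i j then 1 else 0)))).height ≤ n + n := by
    refine (Val.height_ofList_le (k := n) ?_).trans (by simp)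
    intro a ha
    obtain ⟨j, -, rfl⟩ := List.mem_map.1 ha
    simpa using h j
  simp only [encodeGraph, Val.height]
  omega

/-- A tree that describes a node set is a list of numbers. -/
theorem exists_list_of_decodeNodes {n : ℕ} : ∀ {y : Val} {U : Finset (Fin n)},
    decodeNodes n y = some U → ∃ L : List ℕ, y = Val.ofList (L.map Val.nat) ∧
      ∀ i : Fin n, (i : ℕ) ∈ L ↔ i ∈ U
  | .nil, U, h => ⟨[], rfl, by simp [decodeNodes] at h; simp [← h]⟩
  | .pair (.nat k) l, U, h => by
    rw [decodeNodes] at h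
    split at h
    · rename_i hk
      obtain ⟨C, hC, rfl⟩ := Option.map_eq_some_iff.1 h
      obtain ⟨L, rfl, hL⟩ := exists_list_of_decodeNodes hC
      refine ⟨k :: L, rfl, fun i => ?_⟩
      simp [hL, Fin.ext_iff]
    · simp at h
  | .nat _, U, h => by simp [decodeNodes] at h
  | .real _, U, h => by simp [decodeNodes] at h
  | .pair .nil _, U, h => by simp [decodeNodes] at h
  | .pair (.real _) _, U, h => by simp [decodeNodes] at h
  | .pair (.pair _ _) _, U, h => by simp [decodeNodes] at h

end

/-! ### Values of labellings -/

section

variable {n : ℕ}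

/-- The nodes that a list of node-label pairs puts into the block with label `l`. -/
def fiber (a : List (Fin n × Fin n)) (l : Fin n) : Finset (Fin n) :=
  ((a.filter (fun p => p.2 = l)).map Prod.fst).toFinset

/-- The total value of the blocks described by a list of node-label pairs. -/
def asgValue (v : Finset (Fin n) → ℝ) (a : List (Fin n × Fin n)) : ℝ :=
  ∑ l, v (fiber a l)

/-- The total value of the blocks into which the labelling `c` divides the set `Y`. -/
def labelValue (v : Finset (Fin n) → ℝ) (c : Fin n → Fin n) (Y : Finset (Fin n)) : ℝ :=
  ∑ l, v (Y.filter (fun x => c x = l))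

/-- The labelling `c` induces the same partition as the pairs in `a`. -/
def Compat (c : Fin n → Fin n) (a : List (Fin n × Fin n)) : Prop :=
  ∀ p ∈ a, ∀ q ∈ a, p.2 = q.2 ↔ c p.1 = c q.1

theorem mem_fiber {a : List (Fin n × Fin n)} {l x : Fin n} : x ∈ fiber a l ↔ (x, l) ∈ a := by
  simp [fiber]

theorem asgValue_congr (v : Finset (Fin n) → ℝ) {a b : List (Fin n × Fin n)}
    (h : ∀ p, p ∈ a ↔ p ∈ b) : asgValue v a = asgValue v b := by
  unfold asgValue
  congr! 2 with l
  ext x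
  rw [mem_fiber, mem_fiber, h]

variable {v : Finset (Fin n) → ℝ} {G : SimpleGraph (Fin n)}

/-- The nodes of Q are added one at a time, and IDM says that each leaves the marginal contribution
of i unchanged. The cases i ∈ Z and j ∈ Z ∪ Q, which IDM excludes, are trivial because the insertion
changes nothing. -/
theorem IsIDM.insert_union (hv : IsIDM G v) (i : Fin n) (Z : Finset (Fin n)) :
    ∀ Q : Finset (Fin n), (∀ j ∈ Q, i ≠ j ∧ ¬ G.Adj i j) →
      v (insert i (Z ∪ Q)) + v Z = v (insert i Z) + v (Z ∪ Q) := by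
  intro Q
  induction Q using Finset.induction_on with
  | empty => intro _; simp
  | insert j Q hj ih =>
    intro h
    have ih := ih fun k hk => h k (Finset.mem_insert_of_mem hk)
    by_cases hi : i ∈ Z
    · rw [Finset.insert_eq_self.2 hi, Finset.insert_eq_self.2 (Finset.mem_union_left _ hi)]
      ring
    rw [Finset.union_insert]
    by_cases hj' : j ∈ Z ∪ Q
    · rwa [Finset.insert_eq_self.2 hj']
    obtain ⟨hij, hadj⟩ := h j (Finset.mem_insert_self _ _)
    have hi' : i ∉ Z ∪ Q := by
      rw [Finset.mem_union, not_or]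
      exact ⟨hi, fun hk => (h i (Finset.mem_insert_of_mem hk)).1 rfl⟩
    have := hv i j (Z ∪ Q) hij hadj hi' hj'
    linarith

/-- Sets without edges between them contribute independently. -/
theorem IsIDM.union_union (hv : IsIDM G v) (Z Q : Finset (Fin n)) :
    ∀ P : Finset (Fin n), (∀ i ∈ P, ∀ j ∈ Q, i ≠ j ∧ ¬ G.Adj i j) →
      v (Z ∪ P ∪ Q) + v Z = v (Z ∪ P) + v (Z ∪ Q) := by
  intro P
  induction P using Finset.induction_on with
  | empty => intro _; simp [add_comm]
  | insert i P hi ih =>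
    intro h
    have h1 := ih fun k hk => h k (Finset.mem_insert_of_mem hk)
    have h2 := hv.insert_union i (Z ∪ P) Q (h i (Finset.mem_insert_self _ _))
    rw [Finset.union_insert, Finset.insert_union]
    linarith

/-- Induction with `IsIDM.union_union` at Z = ∅, where v ∅ = 0 turns the exchange identity into
additivity. -/
theorem IsIDM.biUnion (hv : IsIDM G v) (h0 : v ∅ = 0) {ι : Type*} [DecidableEq ι]
    (F : ι → Finset (Fin n)) : ∀ I : Finset ι,
    (∀ k ∈ I, ∀ l ∈ I, k ≠ l → ∀ i ∈ F k, ∀ j ∈ F l, i ≠ j ∧ ¬ G.Adj i j) →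
      v (I.biUnion F) = ∑ k ∈ I, v (F k) := by
  intro I
  induction I using Finset.induction_on with
  | empty => intro _; simpa using h0
  | insert k I hk ih =>
    intro h
    have h1 := ih fun a ha b hb => h a (Finset.mem_insert_of_mem ha) b (Finset.mem_insert_of_mem hb)
    have h2 := hv.union_union ∅ (I.biUnion F) (F k) (by
      intro i hi j hj
      obtain ⟨l, hl, hj⟩ := Finset.mem_biUnion.1 hj
      exact h k (Finset.mem_insert_self _ _) l (Finset.mem_insert_of_mem hl)
        (fun e => hk (e ▸ hl)) i hi j hj)
    rw [Finset.biUnion_insert, Finset.sum_insert hk, ← h1]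
    simp only [Finset.empty_union, h0] at h2
    linarith

/-- Unused labels contribute v ∅ = 0, and distinct used labels have distinct blocks. The right side
no longer depends on the names of the labels. -/
theorem labelValue_eq_sum_image (h0 : v ∅ = 0) (c : Fin n → Fin n) (Y : Finset (Fin n)) :
    labelValue v c Y = ∑ C ∈ Y.image (fun x => Y.filter (fun y => c y = c x)), v C := by
  have h1 : labelValue v c Y = ∑ l ∈ Y.image c, v (Y.filter (fun x => c x = l)) := by
    refine (Finset.sum_subset (Finset.subset_univ _) fun l _ hl => ?_).symm
    rw [Finset.filter_eq_empty_iff.2, h0]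
    intro x hx hxl
    exact hl (Finset.mem_image.2 ⟨x, hx, hxl⟩)
  have h2 : Y.image (fun x => Y.filter (fun y => c y = c x)) =
      (Y.image c).image (fun l => Y.filter (fun y => c y = l)) := by
    rw [Finset.image_image]
    rfl
  rw [h1, h2, Finset.sum_image (s := Y.image c)]
  intro l hl l' _ h
  obtain ⟨x, hx, rfl⟩ := Finset.mem_image.1 (Finset.mem_coe.1 hl)
  have : x ∈ Y.filter (fun y => c y = l') := by
    beta_reduce at h
    rw [← h]
    simp [hx]
  exact (Finset.mem_filter.1 this).2

theorem labelValue_congr (h0 : v ∅ = 0) {c d : Fin n → Fin n} {Y : Finset (Fin n)}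
    (h : ∀ x ∈ Y, ∀ y ∈ Y, c x = c y ↔ d x = d y) : labelValue v c Y = labelValue v d Y := by
  rw [labelValue_eq_sum_image h0, labelValue_eq_sum_image h0]
  congr 1
  refine Finset.image_congr fun x hx => Finset.filter_congr fun y hy => h y hy x hx

/-- The list itself defines a labelling d of its nodes. By `Compat`, d and c induce the same
partition there, even if their labels have different names. -/
theorem asgValue_eq_labelValue (h0 : v ∅ = 0) {a : List (Fin n × Fin n)} {c : Fin n → Fin n}
    (hc : Compat c a) : asgValue v a = labelValue v c (a.map Prod.fst).toFinset := by
  have hex : ∀ x, ∃ l, x ∈ (a.map Prod.fst).toFinset → (x, l) ∈ a := by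
    intro x
    by_cases hx : x ∈ (a.map Prod.fst).toFinset
    · obtain ⟨p, hp, rfl⟩ := List.mem_map.1 (List.mem_toFinset.1 hx)
      exact ⟨p.2, fun _ => hp⟩
    · exact ⟨x, fun h => absurd h hx⟩
  choose d hd using hex
  rw [← labelValue_congr h0 (c := d) fun x hx y hy => hc _ (hd x hx) _ (hd y hy)]
  unfold asgValue labelValue
  congr! 2 with l
  ext x
  rw [mem_fiber, Finset.mem_filter]
  constructor
  · intro hx
    have hx' : x ∈ (a.map Prod.fst).toFinset := List.mem_toFinset.2 (List.mem_map.2 ⟨_, hx, rfl⟩)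
    exact ⟨hx', (hc _ (hd x hx') _ hx).2 rfl⟩
  · rintro ⟨hx, rfl⟩
    exact hd x hx

/-- The decoupling identity: within each label class, the members from A and those from B are
separated, so `IsIDM.union_union` applies class by class. -/
theorem labelValue_union (hv : IsIDM G v) (c : Fin n → Fin n) {D A B : Finset (Fin n)}
    (h : ∀ i ∈ A, ∀ j ∈ B, i ≠ j ∧ ¬ G.Adj i j) :
    labelValue v c (D ∪ A ∪ B) + labelValue v c D =
      labelValue v c (D ∪ A) + labelValue v c (D ∪ B) := by
  unfold labelValue
  rw [← Finset.sum_add_distrib, ← Finset.sum_add_distrib]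
  refine Finset.sum_congr rfl fun l _ => ?_
  simp only [Finset.filter_union]
  exact hv.union_union _ _ _ fun i hi j hj =>
    h i (Finset.mem_filter.1 hi).1 j (Finset.mem_filter.1 hj).1

theorem asgValue_append (hv : IsIDM G v) {a r q : List (Fin n × Fin n)}
    (h : ∀ i ∈ r.map Prod.fst, ∀ j ∈ q.map Prod.fst, i ≠ j ∧ ¬ G.Adj i j) :
    asgValue v (r ++ q ++ a) + asgValue v a = asgValue v (r ++ a) + asgValue v (q ++ a) := by
  unfold asgValue
  rw [← Finset.sum_add_distrib, ← Finset.sum_add_distrib]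
  refine Finset.sum_congr rfl fun l _ => ?_
  have key := hv.union_union (fiber a l) (fiber q l) (fiber r l) fun i hi j hj =>
    h i (List.mem_map.2 ⟨_, mem_fiber.1 hi, rfl⟩) j (List.mem_map.2 ⟨_, mem_fiber.1 hj, rfl⟩)
  convert key using 3 <;> ext x <;> simp only [Finset.mem_union, mem_fiber, List.mem_append] <;>
    tauto

/-! ### Optimal extensions -/

/-- The pairs in `e` label the nodes of `Y`, and extend the partition described by `a` in an
optimal way. -/
structure OptExt (v : Finset (Fin n) → ℝ) (a : List (Fin n × Fin n)) (Y : List (Fin n))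
    (e : List (Fin n × Fin n)) : Prop where
  perm : (e.map Prod.fst).Perm Y
  le : ∀ c, Compat c a →
    labelValue v c ((a.map Prod.fst).toFinset ∪ Y.toFinset) ≤ asgValue v (e ++ a)

theorem optExt_nil (h0 : v ∅ = 0) (a : List (Fin n × Fin n)) : OptExt v a [] [] where
  perm := by simp
  le c hc := by simp [asgValue_eq_labelValue h0 hc]

theorem OptExt.perm_right {a e : List (Fin n × Fin n)} {Y Y' : List (Fin n)}
    (h : OptExt v a Y e) (hY : Y.Perm Y') : OptExt v a Y' e where
  perm := h.perm.trans hY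
  le c hc := by
    rw [← List.toFinset_eq_of_perm _ _ hY]
    exact h.le c hc

/-- In the decoupling identity the value of the labelled set is fixed by a, so the bounds for the
two sides simply add up. One list is reversed because list concatenation by a fold reverses its
first argument. -/
theorem OptExt.append (hv : IsIDM G v) (h0 : v ∅ = 0) {a r q : List (Fin n × Fin n)}
    {A B : List (Fin n)} (hr : OptExt v a A r) (hq : OptExt v a B q)
    (h : ∀ i ∈ A, ∀ j ∈ B, i ≠ j ∧ ¬ G.Adj i j) : OptExt v a (A ++ B) (r.reverse ++ q) where
  perm := by
    rw [List.map_append]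
    exact (((List.reverse_perm r).map _).trans hr.perm).append hq.perm
  le c hc := by
    have h1 := hr.le c hc
    have h2 := hq.le c hc
    have h3 := labelValue_union (D := (a.map Prod.fst).toFinset) (A := A.toFinset)
      (B := B.toFinset) hv c (by simpa using h)
    have h4 := asgValue_append (a := a) (r := r) (q := q) hv fun i hi j hj =>
      h i (hr.perm.mem_iff.1 hi) j (hq.perm.mem_iff.1 hj)
    have h5 := asgValue_eq_labelValue h0 hc
    have h6 : asgValue v (r.reverse ++ q ++ a) = asgValue v (r ++ q ++ a) :=
      asgValue_congr v fun p => by simp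
    rw [List.toFinset_append, ← Finset.union_assoc, h6]
    linarith

/-- A labelling compatible with a puts x either into the block of some labelled node or into a block
that meets none, and is thus compatible with one of the extensions tried. The label x is new because
every label in a is itself a labelled node. -/
theorem OptExt.cons {a e : List (Fin n × Fin n)} {x : Fin n} {Y : List (Fin n)}
    (hx : x ∉ a.map Prod.fst) (ha : ∀ p ∈ a, p.2 ∈ a.map Prod.fst)
    (he : (e.map Prod.fst).Perm (x :: Y))
    (h : ∀ l, (l = x ∨ ∃ p ∈ a, p.2 = l) → ∃ r, OptExt v ((x, l) :: a) Y r ∧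
      asgValue v (r ++ (x, l) :: a) ≤ asgValue v (e ++ a)) : OptExt v a (x :: Y) e where
  perm := he
  le c hc := by
    have key : ∃ l, (l = x ∨ ∃ p ∈ a, p.2 = l) ∧ Compat c ((x, l) :: a) := by
      by_cases hcx : ∃ p ∈ a, c p.1 = c x
      · obtain ⟨p, hp, hpx⟩ := hcx
        refine ⟨p.2, Or.inr ⟨p, hp, rfl⟩, ?_⟩
        intro q hq q' hq'
        rcases List.mem_cons.1 hq with rfl | hq <;> rcases List.mem_cons.1 hq' with rfl | hq'
        · simp
        · simpa only [← hpx] using hc p hp q' hq'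
        · simpa only [← hpx] using hc q hq p hp
        · exact hc q hq q' hq'
      · push Not at hcx
        refine ⟨x, Or.inl rfl, ?_⟩
        intro q hq q' hq'
        rcases List.mem_cons.1 hq with rfl | hq <;> rcases List.mem_cons.1 hq' with rfl | hq'
        · simp
        · have h1 := hcx q' hq'
          refine ⟨fun h2 => ?_, fun h2 => absurd h2.symm h1⟩
          exact absurd (by rw [show x = q'.2 from h2]; exact ha q' hq') hx
        · have h1 := hcx q hq
          refine ⟨fun h2 => ?_, fun h2 => absurd h2 h1⟩
          exact absurd (by rw [← show q.2 = x from h2]; exact ha q hq) hx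
        · exact hc q hq q' hq'
    obtain ⟨l, hl, hcl⟩ := key
    obtain ⟨r, hr, hle⟩ := h l hl
    refine le_trans (le_of_eq ?_) ((hr.le c hcl).trans hle)
    congr 1
    ext y
    simp only [List.toFinset_cons, Finset.mem_union, Finset.mem_insert, List.map_cons]
    tauto

/-! ### Refinement into connected blocks -/

/-- Edges inside the blocks of the labelling `c`. -/
def blockGraph (G : SimpleGraph (Fin n)) (c : Fin n → Fin n) : SimpleGraph (Fin n) where
  Adj x y := G.Adj x y ∧ c x = c y
  symm := ⟨fun _ _ h => ⟨h.1.symm, h.2.symm⟩⟩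
  loopless := ⟨fun _ h => h.1.ne rfl⟩

/-- Give the block of `u` the label of `w`. -/
def merge (d : Fin n → Fin n) (u w x : Fin n) : Fin n := if d x = d u then d w else d x

theorem merge_reachable {H : SimpleGraph (Fin n)} {d : Fin n → Fin n} {u w : Fin n}
    (hd : ∀ x y, d x = d y → H.Reachable x y) (huw : H.Adj u w) :
    ∀ x y, merge d u w x = merge d u w y → H.Reachable x y := by
  intro x y hxy
  have h := huw.reachable
  unfold merge at hxy
  split at hxy <;> rename_i hx <;> split at hxy <;> rename_i hy
  · exact hd _ _ (hx.trans hy.symm)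
  · exact (hd _ _ hx).trans (h.trans (hd _ _ hxy))
  · exact (hd _ _ hxy).trans (h.symm.trans (hd _ _ hy.symm))
  · exact hd _ _ hxy

theorem merge_eq_of_eq {d : Fin n → Fin n} {u w x y : Fin n} (h : d x = d y) :
    merge d u w x = merge d u w y := by
  simp [merge, h]

theorem merge_self {d : Fin n → Fin n} {u w : Fin n} : merge d u w u = merge d u w w := by
  simp [merge]

/-- An edge of G inside a c-block is an edge of the block graph, so there are no edges between
different d-blocks of one c-block, and v is additive over them. Both sides become the same double
sum over pairs of labels. -/
theorem labelValue_refine (hv : IsIDM G v) (h0 : v ∅ = 0) {c d : Fin n → Fin n}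
    (h : ∀ x y, d x = d y ↔ (blockGraph G c).Reachable x y) :
    labelValue v c Finset.univ = labelValue v d Finset.univ := by
  have hdc : ∀ x y, d x = d y → c x = c y := by
    intro x y hxy
    obtain ⟨w⟩ := (h x y).1 hxy
    induction w with
    | nil => rfl
    | cons hadj w ih =>
      exact hadj.2.trans (ih ((h _ _).2 ⟨w⟩))
  have h1 : ∀ l, v (Finset.univ.filter fun x => c x = l) =
      ∑ k, v (Finset.univ.filter fun x => c x = l ∧ d x = k) := by
    intro l
    rw [← hv.biUnion h0 (fun k => Finset.univ.filter fun x => c x = l ∧ d x = k)]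
    · congr 1
      ext x
      simp
    · intro k _ k' _ hk i hi j hj
      simp only [Finset.mem_filter, Finset.mem_univ, true_and] at hi hj
      refine ⟨fun hij => hk (by rw [← hi.2, ← hj.2, hij]), fun hij => hk ?_⟩
      rw [← hi.2, ← hj.2, h]
      exact SimpleGraph.Adj.reachable (G := blockGraph G c) ⟨hij, hi.1.trans hj.1.symm⟩
  have h2 : ∀ k, v (Finset.univ.filter fun x => d x = k) =
      ∑ l, v (Finset.univ.filter fun x => c x = l ∧ d x = k) := by
    intro k
    by_cases hk : ∃ x, d x = k
    · obtain ⟨x, rfl⟩ := hk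
      rw [Finset.sum_eq_single (c x)]
      · congr 1
        ext y
        simp only [Finset.mem_filter, Finset.mem_univ, true_and]
        exact ⟨fun hy => ⟨hdc _ _ hy, hy⟩, fun hy => hy.2⟩
      · intro l _ hl
        rw [Finset.filter_eq_empty_iff.2, h0]
        rintro y - ⟨hy, hy'⟩
        exact hl (hy ▸ (hdc _ _ hy'))
      · simp
    · push Not at hk
      rw [Finset.filter_eq_empty_iff.2 (by simpa using hk), h0, Finset.sum_eq_zero]
      intro l _
      rw [Finset.filter_eq_empty_iff.2 (by simp [hk]), h0]
  unfold labelValue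
  simp_rw [h1, h2]
  rw [Finset.sum_comm]

theorem totalValue_eq_labelValue (h0 : v ∅ = 0) (P : CoalitionStructure n) {c : Fin n → Fin n}
    (hP : P.parts = Finset.univ.image fun x => Finset.univ.filter fun y => c y = c x) :
    totalValue v P = labelValue v c Finset.univ := by
  rw [labelValue_eq_sum_image h0, totalValue, hP]

theorem exists_label (P : CoalitionStructure n) : ∃ c : Fin n → Fin n,
    P.parts = Finset.univ.image fun x => Finset.univ.filter fun y => c y = c x := by
  classical
  -- A representative of each part, lying in that part, serves as its label; disjointness of the
  -- parts makes the labels distinct.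
  have hex : ∀ C : Finset (Fin n), ∃ f : Fin n → Fin n, ∀ x ∈ C, f x ∈ C ∧ ∀ y ∈ C, f y = f x := by
    intro C
    by_cases hC : C.Nonempty
    · obtain ⟨z, hz⟩ := hC
      exact ⟨fun _ => z, fun x hx => ⟨hz, fun _ _ => rfl⟩⟩
    · exact ⟨id, fun x hx => absurd ⟨x, hx⟩ hC⟩
  choose f hf using hex
  have hmem : ∀ x, x ∈ P.part x := fun x => P.mem_part (Finset.mem_univ x)
  have hparts : ∀ x, P.part x ∈ P.parts := fun x => P.part_mem.2 (Finset.mem_univ x)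
  have hker : ∀ x y, f (P.part y) y = f (P.part x) x ↔ y ∈ P.part x := by
    intro x y
    constructor
    · intro h
      have h1 := (hf _ y (hmem y)).1
      have h2 := (hf _ x (hmem x)).1
      rw [h] at h1
      rw [P.eq_of_mem_parts (hparts x) (hparts y) h2 h1]
      exact hmem y
    · intro h
      rw [P.part_eq_of_mem (hparts x) h]
      exact (hf _ x (hmem x)).2 y h
  refine ⟨fun x => f (P.part x) x, ?_⟩
  have hfib : ∀ x, (Finset.univ.filter fun y => f (P.part y) y = f (P.part x) x) = P.part x := by
    intro x
    ext y
    simp [hker]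
  ext C
  simp only [hfib, Finset.mem_image, Finset.mem_univ, true_and]
  constructor
  · intro hC
    obtain ⟨x, hx⟩ := P.nonempty_of_mem_parts hC
    exact ⟨x, P.part_eq_of_mem hC hx⟩
  · rintro ⟨x, rfl⟩
    exact hparts x

theorem exists_coalitionStructure (c : Fin n → Fin n) : ∃ P : CoalitionStructure n,
    P.parts = Finset.univ.image fun x => Finset.univ.filter fun y => c y = c x := by
  classical
  refine ⟨Finpartition.ofExistsUnique
    (Finset.univ.image fun x => Finset.univ.filter fun y => c y = c x) (by simp) ?_ ?_, rfl⟩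
  · intro x _
    refine ⟨Finset.univ.filter fun y => c y = c x, by simp, ?_⟩
    intro C hC
    obtain ⟨⟨z, -, rfl⟩, hx⟩ := (by simpa only [Finset.mem_image] using hC)
    have : c x = c z := by simpa using hx
    simp [this]
  · intro h
    obtain ⟨x, -, hx⟩ := Finset.mem_image.1 h
    have : x ∈ (∅ : Finset (Fin n)) := by rw [← hx]; simp
    simp at this

/-- The blocks are the components of the block graph, whose edges are edges of G. -/
theorem isConnectedCS_of_reachable {P : CoalitionStructure n} {c d : Fin n → Fin n}
    (hP : P.parts = Finset.univ.image fun x => Finset.univ.filter fun y => d y = d x)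
    (h : ∀ x y, d x = d y ↔ (blockGraph G c).Reachable x y) : IsConnectedCS G P := by
  intro C hC
  rw [hP] at hC
  obtain ⟨x, -, rfl⟩ := Finset.mem_image.1 hC
  have hset : ((Finset.univ.filter fun y => d y = d x : Finset (Fin n)) : Set (Fin n)) =
      ((blockGraph G c).connectedComponentMk x).supp := by
    ext y
    simp only [Finset.coe_filter, Finset.mem_univ, true_and, Set.mem_ofPred_eq, h,
      SimpleGraph.ConnectedComponent.mem_supp_iff, SimpleGraph.ConnectedComponent.eq]
  rw [hset]
  have h1 : ((blockGraph G c).induce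
      ((blockGraph G c).connectedComponentMk x).supp).Connected :=
    ((blockGraph G c).connectedComponentMk x).connected_toSimpleGraph
  refine h1.mono ?_
  intro a b hab
  exact hab.1

/-- Refining an optimal labelling into connected blocks gives an optimal connected coalition
structure. -/
theorem exists_isOptimalCS (hv : IsIDM G v) (h0 : v ∅ = 0) {c d : Fin n → Fin n}
    (hc : ∀ c', labelValue v c' Finset.univ ≤ labelValue v c Finset.univ)
    (h : ∀ x y, d x = d y ↔ (blockGraph G c).Reachable x y) :
    ∃ P : CoalitionStructure n,
      P.parts = (Finset.univ.image fun x => Finset.univ.filter fun y => d y = d x) ∧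
      IsOptimalCS G v P := by
  obtain ⟨P, hP⟩ := exists_coalitionStructure d
  refine ⟨P, hP, isConnectedCS_of_reachable hP h, fun Q => ?_⟩
  obtain ⟨c', hc'⟩ := exists_label Q
  rw [totalValue_eq_labelValue h0 Q hc', totalValue_eq_labelValue h0 P hP,
    ← labelValue_refine hv h0 h]
  exact hc c'

end

/-! ### Encodings -/

section

variable {n : ℕ}

/-- A list of nodes. -/
def encNodes (L : List (Fin n)) : Val := Val.ofList (L.map fun i : Fin n => Val.nat i)

/-- A node-label pair. -/
def encPair (p : Fin n × Fin n) : Val := .pair (.nat p.1) (.nat p.2)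

/-- A list of node-label pairs. -/
def encAsg (a : List (Fin n × Fin n)) : Val := Val.ofList (a.map encPair)

open Classical in
/-- The adjacency matrix. -/
noncomputable def encRows (G : SimpleGraph (Fin n)) : Val :=
  Val.ofList ((List.finRange n).map fun i =>
    Val.ofList ((List.finRange n).map fun j => .nat (if G.Adj i j then 1 else 0)))

/-- All nodes, in decreasing order. -/
def allNodes (n : ℕ) : List (Fin n) := (List.finRange n).reverse

theorem mem_allNodes (x : Fin n) : x ∈ allNodes n := by simp [allNodes]

theorem nodup_allNodes : (allNodes n).Nodup := by simp [allNodes, List.nodup_finRange]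

theorem length_allNodes : (allNodes n).length = n := by simp [allNodes]

theorem decodeNodes_encNodes (L : List (Fin n)) : decodeNodes n (encNodes L) = some L.toFinset := by
  induction L with
  | nil => rfl
  | cons a L ih =>
    have : encNodes (a :: L) = .pair (.nat a) (encNodes L) := rfl
    rw [this, decodeNodes, dif_pos a.2, ih]
    simp

theorem decodeFamily_ofList {α : Type} (F : α → List (Fin n)) (L : List α) :
    decodeFamily n (Val.ofList (L.map fun a => encNodes (F a))) =
      some (L.map fun a => (F a).toFinset).toFinset := by
  induction L with
  | nil => rfl
  | cons a L ih =>
    simp [Val.ofList, decodeFamily, decodeNodes_encNodes, ih]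

theorem valueOracle_encNodes (v : Finset (Fin n) → ℝ) (L : List (Fin n)) :
    valueOracle v (encNodes L) = some (v L.toFinset) := by
  simp [valueOracle, decodeNodes_encNodes]

theorem length_le_of_nodup {L : List (Fin n)} (h : L.Nodup) : L.length ≤ n := by
  simpa using h.length_le_card

variable {O : Val → Option ℝ} {s p q c l i e : Prog} {x y z : Val} {a b d : ℕ}

open Classical in
theorem Runs.entryP {G : SimpleGraph (Fin n)} {r : Prog} {i j : Fin n}
    (hr : Runs O s b n a r x (encRows G)) (hp : Runs O s b n a p x (.nat i))
    (hq : Runs O s b n a q x (.nat j)) :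
    Runs O s b n (a + 24) (entryP r p q) x (.nat (if G.Adj i j then 1 else 0)) := by
  have h1 := Runs.nthP i.2.le (u := Val.ofList ((List.finRange n).map fun j =>
    Val.nat (if G.Adj i j then 1 else 0))) (by simp) hp hr
  exact (Runs.nthP j.2.le (by simp) hq h1).mono (by omega)

/-! ### Evaluation of a labelling -/

/-- The total value of the blocks described by the list of node-label pairs computed by `a`. -/
def valP (nodes a : Prog) : Prog :=
  foldP nodes (.seq nilP .query) (op2 .realAdd (var 1)
    (.seq (selP (lift2 a) (eqP (sndP (var 0)) (var 2)) (fstP (var 0))) .query))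

theorem Runs.valP {v : Finset (Fin n) → ℝ} (h0 : v ∅ = 0) {A : List (Fin n × Fin n)}
    (hA : A.length ≤ n) (hn : Runs (valueOracle v) s b n a p x (encNodes (allNodes n)))
    (hq : Runs (valueOracle v) s b n d q x (encAsg A)) :
    Runs (valueOracle v) s b n (max a d + 60) (valP p q) x (.real (asgValue v A)) := by
  obtain ⟨g, hg, rfl⟩ := Runs.fold (enc := fun i : Fin n => Val.nat i) (L := allNodes n)
    (i := .seq nilP .query) (f := d + 45)
    (e := GCSG.op2 .realAdd (var 1) (.seq (GCSG.selP (GCSG.lift2 q)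
      (GCSG.eqP (GCSG.sndP (var 0)) (var 2)) (GCSG.fstP (var 0))) .query))
    (fun pre g => g = .real ((pre.map fun l => v (fiber A l)).sum)) length_allNodes.le hn
    -- The machine has no real constants: the initial 0 is obtained by asking for v ∅.
    (runs_nilP.seq (.query (r := 0) (by simp [valueOracle, decodeNodes, h0]))) (by simp)
    (by
      rintro pre l suf _ hL rfl
      refine ⟨_, ?_, rfl⟩
      have hs := Runs.selP (x := .pair (.nat l) (.pair (.real ((pre.map fun l =>
        v (fiber A l)).sum)) x)) (L := A) (enc := encPair) (fun p => p.2 = l)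
        (fun p => .nat p.1) hA hq.lift2
        (c := GCSG.eqP (GCSG.sndP (var 0)) (var 2)) (e := GCSG.fstP (var 0))
        (fun u _ r => by
          simp_rw [Fin.ext_iff]
          exact (runs_var_zero.sndP).eqP runs_var2)
        (fun u _ _ r => runs_var_zero.fstP)
      have h1 : ((A.filter fun p => p.2 = l).map fun p => Val.nat (p.1 : ℕ)).reverse =
          ((A.filter fun p => p.2 = l).map Prod.fst).reverse.map fun i : Fin n => Val.nat i := by
        simp
      rw [h1] at hs
      refine (runs_var1.op2 (hs.seq (.query (valueOracle_encNodes _ _))) ?_).mono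
        (by omega)
      simp [Op.eval, fiber])
  have hsum : ((allNodes n).map fun l => v (fiber A l)).sum = asgValue v A := by
    rw [allNodes, List.map_reverse, List.sum_reverse, asgValue, Fin.sum_univ_def]
  rw [hsum] at hg
  exact hg.mono (by omega)

/-! ### Induced subgraphs -/

/-- The node number `i` of the reversed list. -/
def embed (W : List (Fin n)) (i : Fin W.length) : Fin n :=
  W.reverse[(i : ℕ)]'(by simp)

theorem map_finRange_embed (W : List (Fin n)) :
    (List.finRange W.length).map (embed W) = W.reverse := by
  apply List.ext_getElem <;> simp [embed]

theorem embed_injective {W : List (Fin n)} (hW : W.Nodup) : Function.Injective (embed W) := by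
  intro i j hij
  have := (List.nodup_reverse.2 hW).getElem_inj_iff.1 hij
  exact Fin.ext this

/-- The subgraph induced by the listed nodes, with the nodes numbered. -/
abbrev listGraph (G : SimpleGraph (Fin n)) (W : List (Fin n)) : SimpleGraph (Fin W.length) :=
  G.comap (embed W)

/-- On an environment that starts with a list of nodes and the adjacency matrix, encode the
induced subgraph. -/
def graphP : Prog :=
  .fork (countP (var 0)) (mapP (var 0) (mapP (var 2) (entryP (var 5) (var 2) (var 0))))

theorem runs_graphP {G : SimpleGraph (Fin n)} {W : List (Fin n)} (hW : W.length ≤ n) {r : Val} :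
    Runs O s b n 90 graphP (.pair (encNodes W) (.pair (encRows G) r))
      (encodeGraph (listGraph G W)) := by
  classical
  -- `mapP` reverses lists, which is why `embed` numbers the nodes along the reversed list.
  have h1 : ∀ F : Fin n → Val, (W.map F).reverse =
      (List.finRange W.length).map fun i => F (embed W i) := by
    intro F
    rw [← List.map_reverse, ← map_finRange_embed, List.map_map]
    rfl
  have h2 : ∀ i, Val.ofList ((W.map fun j => Val.nat (if G.Adj i j then 1 else 0)).reverse) =
      Val.ofList ((List.finRange W.length).map fun j =>
        Val.nat (if G.Adj i (embed W j) then 1 else 0)) := fun i => by rw [h1]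
  have h3 := Runs.mapP (O := O) (s := s) (b := b) (M := n) (l := var 0) (a := 0)
    (e := GCSG.mapP (var 2) (GCSG.entryP (var 5) (var 2) (var 0))) (d := 60)
    (x := .pair (encNodes W) (.pair (encRows G) r))
    (enc := fun i : Fin n => Val.nat i) (L := W)
    (fun i => Val.ofList ((W.map fun j => Val.nat (if G.Adj i j then 1 else 0)).reverse)) hW
    runs_var_zero
    (fun i _ r' => Runs.mono (Runs.mapP (d := 34) _ hW runs_var2 (fun j _ r'' =>
        (Runs.entryP (a := 10) runs_var5 (runs_var2.mono (by omega))
          (runs_var_zero.mono (by omega))))) (by decide))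
  simp_rw [h2] at h3
  rw [h1] at h3
  have h4 := (Runs.countP (O := O) (s := s) (b := b) (M := n) (l := var 0) (a := 0)
    (x := .pair (encNodes W) (.pair (encRows G) r)) (L := W.map fun i : Fin n => Val.nat i) (by simpa)
    runs_var_zero).fork h3
  rw [List.length_map] at h4
  exact Runs.mono h4 (by omega)

/-- The nodes of a list with their numbers in the reversed list. -/
def enumP (w : Prog) : Prog :=
  foldP (mapP w (var 0)) nilP (.fork (.fork (countP (var 1)) (var 0)) (var 1))

/-- A node of a list with its number. -/
def encIndexed (W : List (Fin n)) (i : Fin W.length) : Val := .pair (.nat i) (.nat (embed W i))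

theorem Runs.enumP {W : List (Fin n)} (hW : W.length ≤ n)
    (hw : Runs O s b n a p x (encNodes W)) :
    Runs O s b n (a + 50) (enumP p) x
      (Val.ofList ((List.finRange W.length).reverse.map (encIndexed W))) := by
  have h1 := Runs.mapP (e := var 0) _ hW hw (fun u _ r => runs_var_zero)
  rw [← List.map_reverse] at h1
  obtain ⟨g, hg, rfl⟩ := Runs.fold (i := nilP) (f := 30) (L := W.reverse)
    (enc := fun i : Fin n => Val.nat i)
    (e := .fork (.fork (GCSG.countP (var 1)) (var 0)) (var 1))
    (fun pre g => g = Val.ofList ((pre.zipIdx.map fun u : Fin n × ℕ =>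
      Val.pair (.nat u.2) (.nat u.1)).reverse)) (by simpa using hW) h1 runs_nilP rfl
    (by
      rintro pre u suf _ hL rfl
      have hlen : pre.length ≤ n := by
        have := congrArg List.length hL
        simp only [List.length_reverse, List.length_append, List.length_cons] at this
        omega
      refine ⟨_, ((Runs.fork (Runs.countP (by simpa using hlen) runs_var1) runs_var_zero).fork
        runs_var1).mono (by omega), ?_⟩
      simp [List.zipIdx_append, Val.ofList])
  have h2 : (W.reverse.zipIdx.map fun u : Fin n × ℕ => Val.pair (.nat u.2) (.nat u.1)).reverse =
      (List.finRange W.length).reverse.map (encIndexed W) := by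
    rw [List.map_reverse]
    congr 1
    apply List.ext_getElem <;> simp [encIndexed, embed]
  rw [h2] at hg
  exact hg.mono (by omega)

end

/-! ### Separation of a set of nodes -/

section

variable {n : ℕ}

/-- The listed nodes whose numbers pass the test `t`. -/
def picked (W : List (Fin n)) (t : Fin W.length → Prop) [DecidablePred t] : List (Fin n) :=
  ((List.finRange W.length).filter t).map (embed W)

theorem length_picked {W : List (Fin n)} (t : Fin W.length → Prop) [DecidablePred t] :
    (picked W t).length = {i | t i}.ncard := by
  rw [picked, List.length_map, Set.ncard_eq_toFinset_card', ← List.toFinset_card_of_nodup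
    ((List.nodup_finRange _).filter _)]
  congr 1
  ext i
  simp

theorem mem_picked {W : List (Fin n)} {t : Fin W.length → Prop} [DecidablePred t] {x : Fin n} :
    x ∈ picked W t ↔ ∃ i, t i ∧ embed W i = x := by
  simp [picked]

theorem nodup_picked {W : List (Fin n)} (hW : W.Nodup) (t : Fin W.length → Prop)
    [DecidablePred t] : (picked W t).Nodup :=
  ((List.nodup_finRange _).filter _).map (embed_injective hW)

theorem exists_embed {W : List (Fin n)} {x : Fin n} : (∃ i, embed W i = x) ↔ x ∈ W := by
  rw [← List.mem_reverse, ← map_finRange_embed]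
  simp

variable {O : Val → Option ℝ} {s p q c l i e : Prog} {x y z : Val} {a b d : ℕ}

/-- On an environment that starts with a list of numbered nodes, collect the nodes that pass the
test `c`. -/
def pickP (c : Prog) : Prog := selP (var 0) c (sndP (var 0))

theorem Runs.pickP {W : List (Fin n)} (hW : W.length ≤ n) (t : Fin W.length → Prop)
    [DecidablePred t] {r : Val}
    (hc : ∀ i r', Runs O s b n a c (.pair (encIndexed W i) (.pair r' (.pair
      (Val.ofList ((List.finRange W.length).reverse.map (encIndexed W))) r)))
      (.nat (if t i then 1 else 0))) :
    Runs O s b n (a + 30) (pickP c)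
      (.pair (Val.ofList ((List.finRange W.length).reverse.map (encIndexed W))) r)
      (encNodes (picked W t)) := by
  have h1 := Runs.selP (e := GCSG.sndP (var 0)) t (fun i => Val.nat (embed W i)) (by simpa using hW)
    runs_var_zero (fun i _ => hc i) (fun i _ _ r' => runs_var_zero.sndP)
  have h2 : ((((List.finRange W.length).reverse.filter t).map
      fun i => Val.nat (embed W i)).reverse) = (picked W t).map fun i : Fin n => Val.nat i := by
    rw [List.filter_reverse, List.map_reverse, List.reverse_reverse, picked, List.map_map]
    rfl
  rw [h2] at h1
  exact Runs.mono h1 (by omega)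

/-- Whether the number of the current node lies in the first set of the separation. -/
def inFstP : Prog := memP (fstP (var 0)) (fstP (var 3))

/-- Whether the number of the current node lies in the second set of the separation. -/
def inSndP : Prog := memP (fstP (var 0)) (sndP (var 3))

/-- The lists that encode the state of the search: adjacency matrix, nodes, chosen labels, nodes of
the current separator without label, and the two sides. -/
noncomputable def encState (G : SimpleGraph (Fin n)) (asg : List (Fin n × Fin n))
    (X A B : List (Fin n)) : Val :=
  .pair (encRows G) (.pair (encNodes (allNodes n)) (.pair (encAsg asg)
    (.pair (encNodes X) (.pair (encNodes A) (.pair (encNodes B) .nil)))))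

/-- On an environment that starts with a list of nodes, followed by a state, separate the nodes by
means of `p` and form the new state. -/
def sepP (p : Prog) : Prog :=
  letP (.seq graphP (.fix p)) (letP (enumP (var 1))
    (.fork (var 3) (.fork (var 4) (.fork (var 5)
      (.fork (pickP (.ite inFstP inSndP zeroP))
        (.fork (pickP (.ite inSndP zeroP inFstP))
          (.fork (pickP (.ite inFstP zeroP oneP)) nilP)))))))

/-- With U and V the two node sets found, the new separator is U ∩ V and the sides are U \ V and V \
U. The parameter b of the time bound is the running time t of p on this particular subgraph. -/
theorem runs_sepP {G : SimpleGraph (Fin n)} {asg : List (Fin n × Fin n)} {X A B W : List (Fin n)}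
    {f : ℝ → ℝ} {α T : ℝ} (hW : W.Nodup)
    (hfind : FindsSeparationWithin p f α (listGraph G W) T) :
    ∃ (t : ℕ) (X' A' B' : List (Fin n)), (t : ℝ) ≤ T ∧
      Runs O s t n 130 (sepP p) (.pair (encNodes W) (encState G asg X A B))
        (encState G asg X' A' B') ∧
      (X' ++ A' ++ B').Perm W ∧ (X'.length : ℝ) ≤ f W.length ∧
      (A'.length : ℝ) ≤ α * W.length ∧ (B'.length : ℝ) ≤ α * W.length ∧
      ∀ i ∈ A', ∀ j ∈ B', i ≠ j ∧ ¬ G.Adj i j := by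
  classical
  obtain ⟨y, z, t, hrun, htT, A₀, B₀, U, V, hsep, hy, hU, hz, hV⟩ := hfind
  have hlen := length_le_of_nodup hW
  obtain ⟨Ly, rfl, hLy⟩ := exists_list_of_decodeNodes hy
  obtain ⟨Lz, rfl, hLz⟩ := exists_list_of_decodeNodes hz
  have hheight := Run.height_le hrun
  have hg := height_encodeGraph_le (listGraph G W)
  -- The output lists may contain repetitions; their lengths are bounded by the height of the input,
  -- at most 2n + 1, plus the running time.
  have hlens : 2 * n + 1 + t ≤ cost t n 2 := by
    unfold cost
    nlinarith [Nat.zero_le (t * n), Nat.zero_le (t * n ^ 2)]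
  have hLylen : Ly.length ≤ cost t n 2 := by
    have := Val.length_le_height (Ly.map Val.nat)
    simp only [Val.height, List.length_map] at hheight this
    omega
  have hLzlen : Lz.length ≤ cost t n 2 := by
    have := Val.length_le_height (Lz.map Val.nat)
    simp only [Val.height, List.length_map] at hheight this
    omega
  have htcost : t + 1 ≤ cost t n 0 := by simp [cost]
  -- `fix` makes each `call` inside p refer to p and not to the surrounding procedure, exactly as in
  -- `Exec`.
  have hfix : Runs O s t n 0 (.fix p) (encodeGraph (listGraph G W))
      (.pair (Val.ofList (Ly.map Val.nat)) (Val.ofList (Lz.map Val.nat))) :=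
    (RunsIn.fix ⟨t, le_rfl, Run.of_noOracle hrun⟩).mono htcost
  have hU' : ∀ i, i ∈ U ↔ i ∈ A₀.verts := fun i => by rw [← hU]; simp
  have hV' : ∀ i, i ∈ V ↔ i ∈ B₀.verts := fun i => by rw [← hV]; simp
  have hcover : ∀ i, i ∈ U ∨ i ∈ V := by
    intro i
    rw [hU', hV']
    have : i ∈ (A₀ ⊔ B₀).verts := by rw [hsep.1]; simp
    simpa using this
  have hfst : ∀ (u : Fin W.length) (r r' r'' : Val), Runs O s t n 40 inFstP
      (.pair (encIndexed W u) (.pair r (.pair r' (.pair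
        (.pair (Val.ofList (Ly.map Val.nat)) (Val.ofList (Lz.map Val.nat))) r''))))
      (.nat (if u ∈ U then 1 else 0)) := by
    intro u r r' r''
    have := Runs.memP (p := fstP (var 0)) (x := .pair (encIndexed W u) (.pair r (.pair r' (.pair
        (.pair (Val.ofList (Ly.map Val.nat)) (Val.ofList (Lz.map Val.nat))) r'')))) hLylen
      (runs_var_zero (u := encIndexed W u) (O := O) (s := s)).fstP
      (runs_var3 (u := encIndexed W u) (u1 := r) (u2 := r') (r := r'') (O := O) (s := s)).fstP
    simp only [hLy] at this
    exact this.mono (by decide)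
  have hsnd : ∀ (u : Fin W.length) (r r' r'' : Val), Runs O s t n 40 inSndP
      (.pair (encIndexed W u) (.pair r (.pair r' (.pair
        (.pair (Val.ofList (Ly.map Val.nat)) (Val.ofList (Lz.map Val.nat))) r''))))
      (.nat (if u ∈ V then 1 else 0)) := by
    intro u r r' r''
    have := Runs.memP (p := fstP (var 0)) (x := .pair (encIndexed W u) (.pair r (.pair r' (.pair
        (.pair (Val.ofList (Ly.map Val.nat)) (Val.ofList (Lz.map Val.nat))) r'')))) hLzlen
      (runs_var_zero (u := encIndexed W u) (O := O) (s := s)).fstP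
      (runs_var3 (u := encIndexed W u) (u1 := r) (u2 := r') (r := r'') (O := O) (s := s)).sndP
    simp only [hLz] at this
    exact this.mono (by decide)
  -- Since U and V cover all nodes, V \ U is the complement of U.
  refine ⟨t, picked W (fun i => i ∈ U ∧ i ∈ V), picked W (fun i => i ∈ U ∧ i ∉ V),
    picked W (fun i => i ∉ U), htT, ?_, ?_, ?_, ?_, ?_, ?_⟩
  · refine Runs.mono (Runs.letP (d := 100) ((runs_graphP hlen).seq hfix)
      (Runs.mono (Runs.letP (d := 90) (Runs.enumP hlen runs_var1) ?_) (by decide))) (by decide)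
    refine Runs.mono (runs_var3.fork (runs_var4.fork (runs_var5.fork
      (Runs.fork (Runs.pickP (a := 42) hlen _ ?_)
      (Runs.fork (Runs.pickP (a := 42) hlen _ ?_)
      (Runs.fork (Runs.pickP (a := 42) hlen _ ?_) runs_nilP)))))) (by decide)
    · intro i r'
      refine Runs.mono (Runs.ite (P := i ∈ U) (hfst _ _ _ _) (d := 40) (fun h => ?_)
        (fun h => ?_)) (by decide)
      · simpa [h] using hsnd _ _ _ _
      · simpa [h] using runs_zeroP.mono (by decide)
    · intro i r'
      refine Runs.mono (Runs.ite (P := i ∈ V) (hsnd _ _ _ _) (d := 40) (fun h => ?_)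
        (fun h => ?_)) (by decide)
      · simpa [h] using runs_zeroP.mono (by decide)
      · simpa [h] using hfst _ _ _ _
    · intro i r'
      refine Runs.mono (Runs.ite (P := i ∈ U) (hfst _ _ _ _) (d := 40) (fun h => ?_)
        (fun h => ?_)) (by decide)
      · simpa [h] using runs_zeroP.mono (by decide)
      · simpa [h] using runs_oneP.mono (by decide)
  · rw [List.perm_ext_iff_of_nodup _ hW]
    · intro x
      simp only [List.mem_append, mem_picked, ← exists_embed (W := W)]
      constructor
      · rintro ((⟨i, -, hi⟩ | ⟨i, -, hi⟩) | ⟨i, -, hi⟩) <;> exact ⟨i, hi⟩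
      · rintro ⟨i, hi⟩
        by_cases h1 : i ∈ U
        · by_cases h2 : i ∈ V
          · exact Or.inl (Or.inl ⟨i, ⟨h1, h2⟩, hi⟩)
          · exact Or.inl (Or.inr ⟨i, ⟨h1, h2⟩, hi⟩)
        · exact Or.inr ⟨i, h1, hi⟩
    · refine List.Nodup.append (List.Nodup.append (nodup_picked hW _) (nodup_picked hW _) ?_)
        (nodup_picked hW _) ?_
      · intro x hx hx'
        obtain ⟨i, hi, rfl⟩ := mem_picked.1 hx
        obtain ⟨j, hj, hij⟩ := mem_picked.1 hx'
        exact hj.2 (embed_injective hW hij ▸ hi.2)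
      · intro x hx hx'
        obtain ⟨j, hj, rfl⟩ := mem_picked.1 hx'
        rcases List.mem_append.1 hx with hx | hx <;> obtain ⟨i, hi, hij⟩ := mem_picked.1 hx <;>
          exact hj (embed_injective hW hij ▸ hi.1)
  · rw [length_picked]
    convert hsep.2.1 using 4
    ext i
    simp [hU', hV']
  · rw [length_picked]
    convert hsep.2.2.1 using 4
    ext i
    simp [hU', hV']
  · rw [length_picked]
    convert hsep.2.2.2 using 4
    ext i
    have := hcover i
    simp only [hU', hV'] at this
    simp only [Set.mem_ofPred_eq, Set.mem_sdiff, hU']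
    tauto
  · intro x hx y hy
    obtain ⟨i, hi, rfl⟩ := mem_picked.1 hx
    obtain ⟨j, hj, rfl⟩ := mem_picked.1 hy
    refine ⟨fun h => hj (embed_injective hW h ▸ hi.1), fun h => ?_⟩
    -- An edge belongs to one of the two subgraphs, hence has both ends in U or both in V.
    have hadj : (A₀ ⊔ B₀).Adj i j := by rw [hsep.1]; exact h
    rcases hadj with hadj | hadj
    · exact hj ((hU' j).2 (A₀.edge_vert hadj.symm))
    · exact hi.2 ((hV' i).2 (B₀.edge_vert hadj))

/-! ### The recursive procedure -/

/-- On an environment that starts with a list of nodes, followed by a state: separate the nodes and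
continue, unless the list is empty. -/
def solveP (p : Prog) : Prog :=
  .ite (.seq (var 0) (.op .isPair)) (.seq (sepP p) .call) nilP

/-- On an environment that consists of a label and a state, give this label to the first
unlabelled node, and continue. -/
def branchP : Prog :=
  .fork (.fork (fstP (var 4)) (var 0))
    (.seq (.fork (var 1) (.fork (var 2)
      (.fork (.fork (.fork (fstP (var 4)) (var 0)) (var 3))
        (.fork (sndP (var 4)) (.fork (var 5) (.fork (var 6) nilP)))))) .call)

/-- Compare a new candidate with the best one so far. -/
def betterP : Prog :=
  .ite (op2 .realLt (valP (var 4) (appP (var 2) (var 5))) (valP (var 4) (appP (var 0) (var 5))))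
    (var 0) (var 2)

/-- The recursive procedure, with `p` for finding separations: find an optimal extension. -/
def searchP (p : Prog) : Prog :=
  .ite (.seq (var 3) (.op .isPair))
    (foldP (var 2) (letP (fstP (var 3)) branchP)
      (letP (.seq (.fork (sndP (var 0)) (sndP (.op .snd))) branchP) betterP))
    (appP (letP (var 4) (solveP p)) (letP (var 5) (solveP p)))

theorem isPair_encNodes (L : List (Fin n)) :
    Op.eval .isPair (encNodes L) = some (.nat (if L ≠ [] then 1 else 0)) := by
  cases L <;> rfl

end

/-! ### Correctness and running time of the recursive procedure -/

section

variable {n : ℕ} {G : SimpleGraph (Fin n)} {v : Finset (Fin n) → ℝ} {p : Prog}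
  {asg : List (Fin n × Fin n)} {x : Fin n} {X A B : List (Fin n)} {T : ℕ}

/-- The chosen labels and the remaining nodes are consistent. -/
structure Valid (asg : List (Fin n × Fin n)) (Y : List (Fin n)) : Prop where
  nodup : (asg.map Prod.fst ++ Y).Nodup
  labels : ∀ q ∈ asg, q.2 ∈ asg.map Prod.fst

theorem Valid.perm {Y Y' : List (Fin n)} (h : Valid asg Y) (hY : Y.Perm Y') : Valid asg Y' where
  nodup := (List.Perm.nodup_iff (hY.append_left _)).1 h.nodup
  labels := h.labels

theorem Valid.left {Y Y' : List (Fin n)} (h : Valid asg (Y ++ Y')) : Valid asg Y where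
  nodup := by
    have := h.nodup
    rw [← List.append_assoc] at this
    exact this.of_append_left
  labels := h.labels

theorem Valid.right {Y Y' : List (Fin n)} (h : Valid asg (Y ++ Y')) : Valid asg Y' :=
  (h.perm List.perm_append_comm).left

theorem Valid.cons {Y : List (Fin n)} (h : Valid asg (x :: Y)) {l : Fin n}
    (hl : l = x ∨ ∃ q ∈ asg, q.2 = l) : Valid ((x, l) :: asg) Y where
  nodup := (List.Perm.nodup_iff List.perm_middle).1 h.nodup
  labels := by
    intro q hq
    rcases List.mem_cons.1 hq with rfl | hq
    · rcases hl with rfl | ⟨q', hq', rfl⟩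
      · simp
      · exact List.mem_cons_of_mem _ (h.labels q' hq')
    · exact List.mem_cons_of_mem _ (h.labels q hq)

theorem Valid.length_le {Y : List (Fin n)} (h : Valid asg Y) : asg.length + Y.length ≤ n := by
  have := length_le_of_nodup h.nodup
  simpa using this

theorem Valid.not_mem {Y : List (Fin n)} (h : Valid asg (x :: Y)) : x ∉ asg.map Prod.fst :=
  fun hx => List.disjoint_of_nodup_append h.nodup hx (by simp)

theorem runs_branchP {s : Prog} {O : Val → Option ℝ} {l : Fin n} {r : List (Fin n × Fin n)}
    (h : RunsIn O s s (encState G ((x, l) :: asg) X A B) (encAsg r) T) :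
    RunsIn O s branchP (.pair (.nat l) (encState G asg (x :: X) A B)) (encAsg ((x, l) :: r))
      (T + cost 0 n 40) := by
  have h1 : Runs O s 0 n 14 (.fork (fstP (var 4)) (var 0))
      (.pair (.nat l) (encState G asg (x :: X) A B)) (encPair (x, l)) :=
    Runs.mono (runs_var4.fstP.fork runs_var_zero) (by decide)
  have h2 : Runs O s 0 n 35 (.fork (var 1) (.fork (var 2)
      (.fork (.fork (.fork (fstP (var 4)) (var 0)) (var 3))
        (.fork (sndP (var 4)) (.fork (var 5) (.fork (var 6) nilP))))))
      (.pair (.nat l) (encState G asg (x :: X) A B)) (encState G ((x, l) :: asg) X A B) :=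
    Runs.mono (runs_var1.fork (runs_var2.fork ((h1.fork runs_var3).fork
      (runs_var4.sndP.fork (runs_var5.fork (runs_var6.fork runs_nilP)))))) (by decide)
  refine (RunsIn.fork h1 (RunsIn.seq h2 (RunsIn.call h))).mono ?_
  have h3 := cost_mono 0 n (show 14 ≤ 35 by decide)
  have h4 := two_pow_mul_cost_le_of 0 n (show 35 + 5 ≤ 40 by decide)
  have h5 := two_pow_le_cost 0 n 35
  omega

theorem runs_betterP {s : Prog} (h0 : v ∅ = 0) {u : Val} {r q : List (Fin n × Fin n)}
    (hr : (r ++ asg).length ≤ n) (hq : (q ++ asg).length ≤ n) :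
    Runs (valueOracle v) s 0 n 120 betterP
      (.pair (encAsg q) (.pair u (.pair (encAsg r) (encState G asg X A B))))
      (encAsg (if asgValue v (r ++ asg) < asgValue v (q ++ asg) then q else r)) := by
  have hval : ∀ (r' : List (Fin n × Fin n)) (i : ℕ), (r' ++ asg).length ≤ n →
      Runs (valueOracle v) s 0 n 4 (var i)
        (.pair (encAsg q) (.pair u (.pair (encAsg r) (encState G asg X A B)))) (encAsg r') →
      Runs (valueOracle v) s 0 n 100 (valP (var 4) (appP (var i) (var 5)))
        (.pair (encAsg q) (.pair u (.pair (encAsg r) (encState G asg X A B))))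
        (.real (asgValue v (r' ++ asg))) := by
    intro r' i hr' hi
    have h1 := Runs.appP (L := r'.map encPair) (L' := asg.map encPair) (M := n)
      (by simp only [List.length_append, List.length_map] at *; omega) hi runs_var5
    have h2 : Val.ofList ((r'.map encPair).reverse ++ asg.map encPair) =
        encAsg (r'.reverse ++ asg) := by
      simp [encAsg]
    rw [h2] at h1
    have h3 := Runs.valP h0 (by simpa using hr') runs_var4 h1
    rw [asgValue_congr v (b := r' ++ asg) (by simp)] at h3
    exact h3.mono (by decide)
  refine Runs.mono (Runs.ite (d := 4) (P := asgValue v (r ++ asg) < asgValue v (q ++ asg))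
    ((hval r 2 hr runs_var2).op2 (hval q 0 hq (runs_var_zero.mono (by decide))) rfl)
    (fun h => ?_) (fun h => ?_)) (by decide)
  · rw [if_pos h]
    exact runs_var_zero.mono (by decide)
  · rw [if_neg h]
    exact runs_var2

/-- One recursive call is made for the new label and one for every pair in `asg`, repeated labels
included: this is the factor `asg.length + 1`. -/
theorem runs_searchP_cons (h0 : v ∅ = 0) (hvalid : Valid asg (x :: X ++ A ++ B))
    (hcall : ∀ l, (l = x ∨ ∃ q ∈ asg, q.2 = l) → ∃ r,
      RunsIn (valueOracle v) (searchP p) (searchP p) (encState G ((x, l) :: asg) X A B)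
        (encAsg r) T ∧ OptExt v ((x, l) :: asg) (X ++ A ++ B) r) :
    ∃ e, RunsIn (valueOracle v) (searchP p) (searchP p) (encState G asg (x :: X) A B) (encAsg e)
      ((asg.length + 1) * (T + cost 0 n 130)) ∧ OptExt v asg (x :: X ++ A ++ B) e := by
  have hlen : ∀ e : List (Fin n × Fin n), (e.map Prod.fst).Perm (x :: X ++ A ++ B) →
      (e ++ asg).length ≤ n := by
    intro e he
    have h1 := he.length_eq
    have h2 := hvalid.length_le
    rw [List.length_map] at h1
    rw [List.length_append]
    omega
  have hperm : ∀ {l r}, OptExt v ((x, l) :: asg) (X ++ A ++ B) r →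
      (((x, l) :: r).map Prod.fst).Perm (x :: X ++ A ++ B) := fun hr => hr.perm.cons x
  have hval : ∀ l r, asgValue v ((x, l) :: r ++ asg) = asgValue v (r ++ (x, l) :: asg) := by
    intro l r
    refine asgValue_congr v fun q => ?_
    simp only [List.cons_append, List.mem_cons, List.mem_append]
    tauto
  -- The new label supplies the initial candidate; the fold over `asg` then keeps a candidate at
  -- least as good as those of all labels tried so far.
  obtain ⟨r₀, hr₀, hopt₀⟩ := hcall x (Or.inl rfl)
  have hinit : RunsIn (valueOracle v) (searchP p) (letP (fstP (var 3)) branchP)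
      (encState G asg (x :: X) A B) (encAsg ((x, x) :: r₀)) (T + cost 0 n 44) := by
    refine (RunsIn.seq (RunsIn.fork (Runs.fstP (b := 0) (M := n) runs_var3) RunsIn.skip)
      (runs_branchP hr₀)).mono ?_
    have h3 := cost_mono 0 n (show 6 + 2 ≤ 40 by decide)
    have h4 := two_pow_mul_cost_le_of 0 n (show 40 + 4 ≤ 44 by decide)
    have h5 := two_pow_le_cost 0 n 40
    omega
  obtain ⟨g, hg, e, rfl, hpe, hbest⟩ := RunsIn.fold (l := var 2) (L := asg) (enc := encPair)
    (i := letP (fstP (var 3)) branchP) (T := T + cost 0 n 126)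
    (e := letP (.seq (.fork (sndP (var 0)) (sndP (.op .snd))) branchP) betterP)
    (fun pre g => ∃ e, g = encAsg e ∧ (e.map Prod.fst).Perm (x :: X ++ A ++ B) ∧
      ∀ l, (l = x ∨ ∃ q ∈ pre, q.2 = l) → ∃ r, OptExt v ((x, l) :: asg) (X ++ A ++ B) r ∧
        asgValue v (r ++ (x, l) :: asg) ≤ asgValue v (e ++ asg))
    (runs_var2 (b := 0) (M := n)) hinit
    ⟨_, rfl, hperm hopt₀, by
      rintro l (rfl | ⟨q, hq, -⟩)
      · exact ⟨r₀, hopt₀, (hval _ _).ge⟩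
      · simp at hq⟩
    (by
      rintro pre q suf _ hL ⟨e, rfl, hpe, hbest⟩
      obtain ⟨r, hr, hopt⟩ := hcall q.2 (Or.inr ⟨q, by simp [hL], rfl⟩)
      have h1 : Runs (valueOracle v) (searchP p) 0 n 10 (.fork (sndP (var 0)) (sndP (.op .snd)))
          (.pair (encPair q) (.pair (encAsg e) (encState G asg (x :: X) A B)))
          (.pair (.nat q.2) (encState G asg (x :: X) A B)) :=
        Runs.mono (Runs.fork runs_var_zero.sndP (Runs.sndP (.op (o := .snd) rfl))) (by decide)
      have h2 := (RunsIn.seq (RunsIn.fork (RunsIn.seq h1 (runs_branchP hr)) RunsIn.skip)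
        (runs_betterP (s := searchP p) (u := encPair q) (G := G) (X := x :: X) (A := A) (B := B)
          h0 (hlen e hpe) (hlen _ (hperm hopt))))
      refine ⟨_, h2.mono ?_, _, rfl, ?_, ?_⟩
      · have h3 := cost_mono 0 n (show 10 ≤ 120 by decide)
        have h4 := cost_mono 0 n (show 40 ≤ 120 by decide)
        have h5 := two_pow_mul_cost_le_of 0 n (show 120 + 6 ≤ 126 by decide)
        have h6 := two_pow_le_cost 0 n 120
        omega
      · split
        · exact hperm hopt
        · exact hpe
      · have hmax : asgValue v (e ++ asg) ≤ asgValue v ((if asgValue v (e ++ asg) <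
              asgValue v ((x, q.2) :: r ++ asg) then (x, q.2) :: r else e) ++ asg) ∧
            asgValue v ((x, q.2) :: r ++ asg) ≤ asgValue v ((if asgValue v (e ++ asg) <
              asgValue v ((x, q.2) :: r ++ asg) then (x, q.2) :: r else e) ++ asg) := by
          split
          · rename_i h
            exact ⟨h.le, le_rfl⟩
          · rename_i h
            exact ⟨le_rfl, not_lt.1 h⟩
        rintro l hl
        by_cases hlq : l = q.2
        · subst hlq
          exact ⟨r, hopt, by rw [← hval]; exact hmax.2⟩
        · obtain ⟨r', hr', hle⟩ := hbest l (by
            rcases hl with hl | ⟨q', hq', hl⟩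
            · exact Or.inl hl
            · rcases List.mem_append.1 hq' with hq' | hq'
              · exact Or.inr ⟨q', hq', hl⟩
              · rw [List.mem_singleton.1 hq'] at hl
                exact absurd hl.symm hlq)
          exact ⟨r', hr', hle.trans hmax.1⟩)
  refine ⟨e, ?_, OptExt.cons hvalid.not_mem hvalid.labels hpe hbest⟩
  refine (RunsIn.ite (P := x :: X ≠ []) (RunsIn.seq (runs_var3 (b := 0) (M := n))
    (RunsIn.op (isPair_encNodes _))) (fun _ => hg) (fun h => absurd (by simp) h)).mono ?_
  have h3 := cost_mono 0 n (show 4 ≤ 126 by decide)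
  have h4 := cost_mono 0 n (show 44 ≤ 126 by decide)
  have h5 := two_pow_mul_cost_le_of 0 n (show 126 + 4 ≤ 130 by decide)
  have h6 := two_pow_le_cost 0 n 126
  have h7 := cost_mono 0 n (show 6 ≤ 126 by decide)
  have h8 : asg.length * (T + cost 0 n 126 + 30) ≤ asg.length * (T + cost 0 n 130) :=
    Nat.mul_le_mul_left _ (by omega)
  rw [add_mul, one_mul]
  omega

/-- Labelling the nodes of `X` multiplies the running time by the number of labellings. -/
theorem runs_searchP_append (h0 : v ∅ = 0) {K : ℕ}
    (hcall : ∀ asg, Valid asg (A ++ B) → asg.length ≤ K → ∃ r,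
      RunsIn (valueOracle v) (searchP p) (searchP p) (encState G asg [] A B) (encAsg r) T ∧
        OptExt v asg (A ++ B) r) :
    ∀ (X : List (Fin n)) (asg : List (Fin n × Fin n)), Valid asg (X ++ A ++ B) →
      asg.length + X.length ≤ K → ∃ r,
      RunsIn (valueOracle v) (searchP p) (searchP p) (encState G asg X A B) (encAsg r)
        ((asg.length + 1).ascFactorial X.length * (T + X.length * cost 0 n 130)) ∧
        OptExt v asg (X ++ A ++ B) r := by
  intro X
  induction X with
  | nil =>
    intro asg hvalid hK
    obtain ⟨r, hr, hopt⟩ := hcall asg hvalid (by simpa using hK)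
    exact ⟨r, by simpa using hr, hopt⟩
  | cons x X ih =>
    intro asg hvalid hK
    have hstep : ∀ l, (l = x ∨ ∃ q ∈ asg, q.2 = l) → _ := fun l hl =>
      ih ((x, l) :: asg) (hvalid.cons hl) (by rw [List.length_cons] at hK ⊢; omega)
    simp only [List.length_cons] at hstep
    obtain ⟨e, he, hopt⟩ := runs_searchP_cons (p := p) (G := G) h0 hvalid hstep
    refine ⟨e, he.mono ?_, hopt⟩
    simp only [List.length_cons]
    -- The first node has k + 1 choices; afterwards k + 1 nodes are labelled, which leaves
    -- (k+2)⋯(k+r+1) branches for the r others.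
    have h1 := Nat.succ_ascFactorial (asg.length + 1) X.length
    have h2 : (asg.length + 1).ascFactorial (X.length + 1) =
        (asg.length + 1) * (asg.length + 1 + 1).ascFactorial X.length := by
      rw [Nat.ascFactorial_succ, ← h1]
    have h3 : 0 < (asg.length + 1 + 1).ascFactorial X.length := Nat.ascFactorial_pos _ _
    rw [h2, mul_assoc]
    refine Nat.mul_le_mul_left _ ?_
    have h4 : cost 0 n 130 ≤ (asg.length + 1 + 1).ascFactorial X.length * cost 0 n 130 :=
      Nat.le_mul_of_pos_left _ h3
    calc _ ≤ (asg.length + 1 + 1).ascFactorial X.length * (T + X.length * cost 0 n 130) +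
          (asg.length + 1 + 1).ascFactorial X.length * cost 0 n 130 := by omega
      _ = _ := by ring

/-- An empty side is answered at once, so `hcall` is demanded for nonempty W only. This is what ends
the recursion. -/
theorem runs_solveP {f : ℝ → ℝ} {α S : ℝ} {W : List (Fin n)} {q : Prog} (h0 : v ∅ = 0)
    (hvalid : Valid asg W)
    (hq : Runs (valueOracle v) (searchP p) 0 n 10 q (encState G asg X A B) (encNodes W))
    (hfind : FindsSeparationWithin p f α (listGraph G W) S)
    (hcall : W ≠ [] → ∀ X' A' B' : List (Fin n), (X' ++ A' ++ B').Perm W →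
      (X'.length : ℝ) ≤ f W.length → (A'.length : ℝ) ≤ α * W.length →
      (B'.length : ℝ) ≤ α * W.length → (∀ i ∈ A', ∀ j ∈ B', i ≠ j ∧ ¬ G.Adj i j) →
      ∃ r, RunsIn (valueOracle v) (searchP p) (searchP p) (encState G asg X' A' B') (encAsg r) T ∧
        OptExt v asg (X' ++ A' ++ B') r) :
    ∃ (t : ℕ) (r : List (Fin n × Fin n)), (t : ℝ) ≤ S ∧
      RunsIn (valueOracle v) (searchP p) (letP q (solveP p)) (encState G asg X A B) (encAsg r)
        (T + cost t n 134) ∧ OptExt v asg W r := by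
  obtain ⟨t, X', A', B', htS, hsep, hperm, hX, hA, hB, hadj⟩ :=
    runs_sepP (O := valueOracle v) (s := searchP p) (asg := asg) (X := X) (A := A) (B := B)
      (List.Nodup.of_append_right hvalid.nodup) hfind
  refine ⟨t, ?_⟩
  have h3 := cost_mono t n (show 10 ≤ 130 by decide)
  have h3' := cost_mono t n (show 0 ≤ 130 by decide)
  have h4 := two_pow_mul_cost_le_of t n (show 130 + 4 ≤ 134 by decide)
  have h6 := two_pow_le_cost t n 130
  have h7 := cost_zero_le t n 10
  by_cases hW : W = []
  · subst hW
    refine ⟨[], htS, ?_, optExt_nil h0 asg⟩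
    refine (RunsIn.seq (RunsIn.fork hq RunsIn.skip) (RunsIn.ite (P := ([] : List (Fin n)) ≠ [])
      (RunsIn.seq (runs_var_zero (b := t) (M := n)) (RunsIn.op (isPair_encNodes _)))
      (fun h => absurd rfl h) (fun _ => runs_nilP (b := t) (M := n)))).mono ?_
    omega
  · obtain ⟨r, hr, hopt⟩ := hcall hW X' A' B' hperm hX hA hB hadj
    refine ⟨r, htS, ?_, hopt.perm_right hperm⟩
    refine (RunsIn.seq (RunsIn.fork hq RunsIn.skip) (RunsIn.ite (P := W ≠ [])
      (RunsIn.seq (runs_var_zero (b := t) (M := n)) (RunsIn.op (isPair_encNodes _)))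
      (fun _ => RunsIn.seq hsep (RunsIn.call hr)) (fun h => absurd hW h))).mono ?_
    omega

theorem runs_searchP_nil (hv : IsIDM G v) (h0 : v ∅ = 0) {Ta Tb : ℕ} {r q : List (Fin n × Fin n)}
    (hvalid : Valid asg (A ++ B)) (hadj : ∀ i ∈ A, ∀ j ∈ B, i ≠ j ∧ ¬ G.Adj i j)
    (hr : RunsIn (valueOracle v) (searchP p) (letP (var 4) (solveP p)) (encState G asg [] A B)
      (encAsg r) Ta) (hropt : OptExt v asg A r)
    (hq : RunsIn (valueOracle v) (searchP p) (letP (var 5) (solveP p)) (encState G asg [] A B)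
      (encAsg q) Tb) (hqopt : OptExt v asg B q) :
    RunsIn (valueOracle v) (searchP p) (searchP p) (encState G asg [] A B)
      (encAsg (r.reverse ++ q)) (Ta + Tb + cost 0 n 20) ∧
      OptExt v asg (A ++ B) (r.reverse ++ q) := by
  refine ⟨?_, hropt.append hv h0 hqopt hadj⟩
  obtain ⟨g, hg, rfl⟩ := RunsIn.fold (e := .fork (var 0) (var 1)) (T := 5) (enc := encPair)
    (fun pre g => g = encAsg (pre.reverse ++ q)) hr hq rfl
    (by
      rintro pre u suf _ hL rfl
      refine ⟨_, RunsIn.mono (RunsIn.fork (a := 1) (b := 3) (RunsIn.op rfl)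
        (RunsIn.seq (RunsIn.op rfl) (RunsIn.op rfl))) le_rfl, by simp [encAsg, Val.ofList]⟩)
  refine (RunsIn.ite (P := ([] : List (Fin n)) ≠ []) (RunsIn.seq (runs_var3 (b := 0) (M := n))
    (RunsIn.op (isPair_encNodes _))) (fun h => absurd rfl h) (fun _ => hg)).mono ?_
  have h1 : r.length ≤ n := by
    have h2 := hropt.perm.length_eq
    have h3 := hvalid.left.length_le
    rw [List.length_map] at h2
    omega
  have h3 := cost_mono 0 n (show 6 ≤ 8 by decide)
  have h4 := two_pow_mul_cost_le_of 0 n (show 8 + 12 ≤ 20 by decide)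
  have h6 := two_pow_le_cost 0 n 8
  have h7 := (le_cost_one (b := 0) h1).trans (cost_mono 0 n (show 1 ≤ 8 by decide))
  omega

end

/-! ### The recurrence for the running time along the levels of the recursion, and the complete
program. -/

section

variable {n : ℕ} {G : SimpleGraph (Fin n)} {v : Finset (Fin n) → ℝ} {p : Prog}

/-- Time bounds for the levels of the recursion: at level `i`, the sides have at most `α ^ i * n`
nodes each, `D i` bounds the number of labelled nodes, `P i` the time for one separation, `U i` the
time for all labellings of one separator, and `V i` the time for a pair of sides. -/
theorem runs_searchP_level (hv : IsIDM G v) (h0 : v ∅ = 0) {f : ℝ → ℝ} {α : ℝ} {σ : ℕ → ℝ}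
    (hα : 0 ≤ α) (hf : MonotoneOn f (Set.Ici 0))
    (hfind : ∀ W : List (Fin n), W.Nodup → FindsSeparationWithin p f α (listGraph G W) (σ W.length))
    {N : ℕ} {D P U V : ℕ → ℝ} (hN : α ^ N * n < 1)
    (hD : ∀ i < N, D i + f (α ^ i * n) ≤ D (i + 1))
    (hP : ∀ i ≤ N, ∀ m t : ℕ, (m : ℝ) ≤ α ^ i * n → (t : ℝ) ≤ σ m → (cost t n 134 : ℝ) ≤ P i)
    (hU0 : ∀ i ≤ N, 0 ≤ U i)
    (hV0 : ∀ i ≤ N, 0 ≤ V i)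
    (hU : ∀ i < N, ∀ k r : ℕ, (k : ℝ) ≤ D i → (r : ℝ) ≤ f (α ^ i * n) → r ≤ n →
      ((k + 1).ascFactorial r : ℝ) * (V (i + 1) + r * cost 0 n 130) ≤ U i)
    (hV : ∀ i ≤ N, 2 * (U i + P i) + cost 0 n 20 ≤ V i) :
    ∀ k i, i + k = N → ∀ (asg : List (Fin n × Fin n)) (A B : List (Fin n)), Valid asg (A ++ B) →
      (∀ i ∈ A, ∀ j ∈ B, i ≠ j ∧ ¬ G.Adj i j) → (A.length : ℝ) ≤ α ^ i * n →
      (B.length : ℝ) ≤ α ^ i * n → (asg.length : ℝ) ≤ D i →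
      ∃ r, RunsIn (valueOracle v) (searchP p) (searchP p) (encState G asg [] A B) (encAsg r)
        ⌊V i⌋₊ ∧ OptExt v asg (A ++ B) r := by
  intro k
  induction k with
  | zero =>
    intro i hi asg A B hvalid hadj hA hB _
    obtain rfl : i = N := by omega
    -- At level N the size bound is below one node, so both sides are empty.
    have hnil : ∀ L : List (Fin n), (L.length : ℝ) ≤ α ^ i * n → L = [] := by
      intro L hL
      have : (L.length : ℝ) < 1 := hL.trans_lt hN
      exact List.length_eq_zero_iff.1 (by exact_mod_cast Nat.lt_one_iff.1 (by exact_mod_cast this))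
    obtain rfl := hnil A hA
    obtain rfl := hnil B hB
    obtain ⟨t, r, ht, hr, hropt⟩ := runs_solveP (T := 0) (X := []) (A := []) (B := []) (p := p)
      (G := G) (asg := asg) h0 hvalid (runs_var4.mono (by decide)) (hfind _ List.nodup_nil)
      (fun h => absurd rfl h)
    obtain ⟨t', q, ht', hq, hqopt⟩ := runs_solveP (T := 0) (X := []) (A := []) (B := []) (p := p)
      (G := G) (asg := asg) h0 hvalid runs_var5 (hfind _ List.nodup_nil)
      (fun h => absurd rfl h)
    obtain ⟨h1, h2⟩ := runs_searchP_nil hv h0 hvalid hadj hr hropt hq hqopt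
    refine ⟨_, h1.mono (Nat.le_floor ?_), h2⟩
    have h3 := hP i le_rfl _ t hA ht
    have h4 := hP i le_rfl _ t' hB ht'
    have h5 := hV i le_rfl
    have h6 := hU0 i le_rfl
    push_cast
    linarith
  | succ k ih =>
    intro i hi asg A B hvalid hadj hA hB hasg
    have hiN : i < N := by omega
    have hside : ∀ (W : List (Fin n)) (w : Prog), Valid asg W → (W.length : ℝ) ≤ α ^ i * n →
        Runs (valueOracle v) (searchP p) 0 n 10 w (encState G asg [] A B) (encNodes W) →
        ∃ (t : ℕ) (r : List (Fin n × Fin n)), (t : ℝ) ≤ σ W.length ∧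
          RunsIn (valueOracle v) (searchP p) (letP w (solveP p)) (encState G asg [] A B) (encAsg r)
            (⌊U i⌋₊ + cost t n 134) ∧ OptExt v asg W r := by
      intro W w hW hlen hw
      refine runs_solveP h0 hW hw (hfind W (List.Nodup.of_append_right hW.nodup)) ?_
      intro _ X' A' B' hperm hX' hA' hB' hadj'
      have hvalid' := hW.perm hperm.symm
      have hX'' : (X'.length : ℝ) ≤ f (α ^ i * n) := hX'.trans
        (hf (Set.mem_Ici.2 (Nat.cast_nonneg _)) (Set.mem_Ici.2 (by positivity)) hlen)
      have hlen' : α * (W.length : ℝ) ≤ α ^ (i + 1) * n := by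
        calc α * (W.length : ℝ) ≤ α * (α ^ i * n) := mul_le_mul_of_nonneg_left hlen hα
          _ = _ := by ring
      obtain ⟨r, hr, hopt⟩ := runs_searchP_append (p := p) (G := G) (T := ⌊V (i + 1)⌋₊) h0
        (K := asg.length + X'.length) (A := A') (B := B')
        (fun asg' hv' hK => ih (i + 1) (by omega) asg' A' B' hv' hadj' (hA'.trans hlen')
          (hB'.trans hlen') (by
            -- Labelling the separator adds at most f(α^i n) labelled nodes, which is what D allows
            -- from level i to level i + 1.
            have h1 := hD i hiN
            have h2 : (asg'.length : ℝ) ≤ asg.length + X'.length := by exact_mod_cast hK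
            linarith)) X' asg hvalid' le_rfl
      refine ⟨r, hr.mono (Nat.le_floor ?_), hopt⟩
      have hXn : X'.length ≤ n := by
        have := hvalid'.length_le
        simp only [List.length_append] at this
        omega
      refine le_trans ?_ (hU i hiN asg.length X'.length hasg hX'' hXn)
      push_cast
      refine mul_le_mul_of_nonneg_left ?_ (by positivity)
      have := Nat.floor_le (hV0 (i + 1) (by omega))
      linarith
    obtain ⟨t, r, ht, hr, hropt⟩ := hside A (var 4) hvalid.left hA (runs_var4.mono (by decide))
    obtain ⟨t', q, ht', hq, hqopt⟩ := hside B (var 5) hvalid.right hB runs_var5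
    obtain ⟨h1, h2⟩ := runs_searchP_nil hv h0 hvalid hadj hr hropt hq hqopt
    refine ⟨_, h1.mono (Nat.le_floor ?_), h2⟩
    have h3 := hP i hiN.le _ t hA ht
    have h4 := hP i hiN.le _ t' hB ht'
    have h5 := hV i hiN.le
    have h6 := Nat.floor_le (hU0 i hiN.le)
    push_cast
    linarith

/-! ### The complete program -/

variable {O : Val → Option ℝ} {s q u : Prog} {x : Val} {b a d : ℕ}

/-- The list `D` consists of all pairs `(x, c x)`. -/
def Represents (D : List (Fin n × Fin n)) (c : Fin n → Fin n) : Prop :=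
  ∀ r, r ∈ D ↔ r.2 = c r.1

/-- Look up the label of a node. -/
def labelP (l u : Prog) : Prog :=
  foldP l zeroP (.ite (eqP (fstP (var 0)) (lift2 u)) (sndP (var 0)) (var 1))

theorem Runs.labelP {D : List (Fin n × Fin n)} {c : Fin n → Fin n} {i : Fin n}
    (hD : Represents D c) (hlen : D.length ≤ n) (hl : Runs O s b n a q x (encAsg D))
    (hu : Runs O s b n d u x (.nat i)) :
    Runs O s b n (max a d + 30) (labelP q u) x (.nat (c i)) := by
  obtain ⟨g, hg, hI⟩ := Runs.fold (i := zeroP) (f := d + 16) (L := D) (enc := encPair)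
    (e := .ite (GCSG.eqP (GCSG.fstP (var 0)) (GCSG.lift2 u)) (GCSG.sndP (var 0)) (var 1))
    (fun pre g => (∃ r ∈ pre, r.1 = i) → g = .nat (c i)) hlen hl runs_zeroP (by simp)
    (by
      rintro pre r suf g hL hg
      refine ⟨if r.1 = i then .nat r.2 else g, Runs.mono (Runs.ite (d := 2) (P := r.1 = i)
        (by
          simp_rw [Fin.ext_iff]
          exact runs_var_zero.fstP.eqP hu.lift2) (fun h => ?_) (fun h => ?_)) (by omega), ?_⟩
      · rw [if_pos h]
        exact runs_var_zero.sndP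
      · rw [if_neg h]
        exact runs_var1
      · rintro ⟨r', hr', rfl⟩
        have hr : r.2 = c r.1 := (hD r).1 (by simp [hL])
        split
        · rename_i h
          rw [hr, h]
        · rename_i h
          refine hg ⟨r', ?_, rfl⟩
          rcases List.mem_append.1 hr' with hr' | hr'
          · exact hr'
          · rw [List.mem_singleton.1 hr'] at h
            exact absurd rfl h)
  have : g = .nat (c i) := hI ⟨(i, c i), (hD _).2 rfl, rfl⟩
  rw [this] at hg
  exact hg.mono (by omega)

/-- The pairs in `D` describe a partition that is at least as fine as that into the components of
the block graph of `c`, and joins the ends of its edges in `S`. -/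
def Refines (G : SimpleGraph (Fin n)) (c : Fin n → Fin n) (S : Fin n → Fin n → Prop)
    (D : List (Fin n × Fin n)) : Prop :=
  D.length ≤ n ∧ ∃ d, Represents D d ∧ (∀ x y, d x = d y → (blockGraph G c).Reachable x y) ∧
    ∀ u w, S u w → (blockGraph G c).Adj u w → d u = d w

/-- Join the blocks of two nodes if these are adjacent and have the same label. -/
def joinP : Prog :=
  .ite (.ite (entryP (var 5) (var 2) (var 0))
      (eqP (labelP (var 4) (var 2)) (labelP (var 4) (var 0))) zeroP)
    (mapP (var 1) (.fork (fstP (var 0))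
      (.ite (eqP (sndP (var 0)) (labelP (var 3) (var 4))) (labelP (var 3) (var 2))
        (sndP (var 0)))))
    (var 1)

/-- Blocks are merged only along an edge of the block graph, so equal labels still imply
reachability. Merging never separates nodes, so pairs treated earlier remain settled. -/
theorem runs_joinP {E D : List (Fin n × Fin n)} {c : Fin n → Fin n} {S : Fin n → Fin n → Prop}
    {u w : Fin n} {r r' : Val} (hE : Represents E c) (hElen : E.length ≤ n)
    (hD : Refines G c S D) :
    ∃ D', Runs O s b n 100 joinP (.pair (.nat w) (.pair (encAsg D) (.pair (.nat u) (.pair r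
        (.pair (encAsg E) (.pair (encRows G) r')))))) (encAsg D') ∧
      Refines G c (fun i j => S i j ∨ (i = u ∧ j = w)) D' := by
  classical
  obtain ⟨hDlen, d, hDd, hreach, hS⟩ := hD
  have hcond : Runs O s b n 70 (.ite (entryP (var 5) (var 2) (var 0))
      (eqP (labelP (var 4) (var 2)) (labelP (var 4) (var 0))) zeroP)
      (.pair (.nat w) (.pair (encAsg D) (.pair (.nat u) (.pair r
        (.pair (encAsg E) (.pair (encRows G) r'))))))
      (.nat (if (blockGraph G c).Adj u w then 1 else 0)) := by
    refine Runs.mono (Runs.ite (P := G.Adj u w) (d := 50) (Runs.entryP (a := 10) runs_var5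
      (runs_var2.mono (by decide)) (runs_var_zero.mono (by decide))) (fun h => ?_) (fun h => ?_))
      (by decide)
    · have h1 := Runs.eqP (Runs.labelP (O := O) (s := s) (b := b) (q := var 4) (u := var 2)
        (x := .pair (.nat w) (.pair (encAsg D) (.pair (.nat u) (.pair r
        (.pair (encAsg E) (.pair (encRows G) r')))))) hE hElen runs_var4 runs_var2)
        (Runs.labelP (u := var 0) hE hElen runs_var4 runs_var_zero)
      have h2 : (blockGraph G c).Adj u w ↔ (c u : ℕ) = c w := by
        simp [blockGraph, h, Fin.ext_iff]
      simp only [h2]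
      exact h1.mono (by decide)
    · rw [if_neg fun h' => h h'.1]
      exact runs_zeroP.mono (by decide)
  by_cases hadj : (blockGraph G c).Adj u w
  · refine ⟨(D.map fun r => (r.1, merge d u w r.1)).reverse, ?_, by simpa using hDlen, merge d u w,
      ?_, merge_reachable hreach hadj, ?_⟩
    · refine Runs.mono (Runs.ite (d := 72) hcond (fun _ => ?_) (fun h => absurd hadj h)) (by decide)
      have h1 : encAsg (D.map fun r => (r.1, merge d u w r.1)).reverse =
          Val.ofList ((D.map fun r => encPair (r.1, merge d u w r.1)).reverse) := by
        simp [encAsg, Function.comp_def]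
      rw [h1]
      refine Runs.mono (Runs.mapP (enc := encPair) (d := 50) _ hDlen runs_var1 fun q hq r'' => ?_)
        (by decide)
      have hq2 : q.2 = d q.1 := (hDd q).1 hq
      refine Runs.mono (runs_var_zero.fstP.fork (Runs.ite (P := d q.1 = d u) (a := 46) (d := 40) ?_
        (fun h => ?_) (fun h => ?_))) (by decide)
      · rw [← hq2]
        simp_rw [Fin.ext_iff]
        exact Runs.mono (d := 46) (Runs.eqP runs_var_zero.sndP
          (Runs.labelP hDd hDlen runs_var3 runs_var4)) (by decide)
      · rw [merge, if_pos h]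
        exact Runs.mono (Runs.labelP hDd hDlen runs_var3 runs_var2) (by decide)
      · rw [merge, if_neg h, ← hq2]
        exact Runs.mono runs_var_zero.sndP (by decide)
    · intro q
      simp only [List.mem_reverse, List.mem_map]
      constructor
      · rintro ⟨r, -, rfl⟩
        rfl
      · intro hq
        exact ⟨(q.1, d q.1), (hDd _).2 rfl, by rw [← hq]⟩
    · rintro i j (hij | ⟨rfl, rfl⟩) h
      · exact merge_eq_of_eq (hS i j hij h)
      · exact merge_self
  · refine ⟨D, Runs.mono (Runs.ite (d := 70) hcond (fun h => absurd h hadj)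
      (fun _ => runs_var1.mono (by decide))) (by decide), hDlen, d, hDd, hreach, ?_⟩
    rintro i j (hij | ⟨rfl, rfl⟩) h
    · exact hS i j hij h
    · exact absurd h hadj

/-- On an environment with a labelling, the adjacency matrix and the list of nodes, refine the
labelling into connected blocks. -/
def refineP : Prog :=
  foldP (var 2) (mapP (var 2) (.fork (var 0) (var 0))) (foldP (var 4) (var 1) joinP)

/-- After the double loop over all pairs of nodes, the ends of each edge of the block graph share a
label. Following a walk yields the direction from reachability to equal labels, so one pass
suffices. -/
theorem runs_refineP {E : List (Fin n × Fin n)} {c : Fin n → Fin n} {r : Val}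
    (hE : Represents E c) (hElen : E.length ≤ n) :
    ∃ (D : List (Fin n × Fin n)) (d : Fin n → Fin n), Runs O s b n 130 refineP
      (.pair (encAsg E) (.pair (encRows G) (.pair (encNodes (allNodes n)) r))) (encAsg D) ∧
      D.length ≤ n ∧ Represents D d ∧ ∀ x y, d x = d y ↔ (blockGraph G c).Reachable x y := by
  have hinit := Runs.mapP (e := .fork (var 0) (var 0)) (enc := fun i : Fin n => Val.nat i)
    (x := .pair (encAsg E) (.pair (encRows G) (.pair (encNodes (allNodes n)) r)))
    (fun i : Fin n => encPair (i, i)) length_allNodes.le (runs_var2 (O := O) (s := s) (b := b))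
    (fun i _ r => runs_var_zero.fork runs_var_zero)
  have h1 : Val.ofList (((allNodes n).map fun i => encPair (i, i)).reverse) =
      encAsg ((allNodes n).map fun i => (i, i)).reverse := by
    simp [encAsg, Function.comp_def]
  rw [h1] at hinit
  obtain ⟨g, hg, D, rfl, hDlen, d, hDd, hreach, hS⟩ := Runs.fold (f := 115)
    (enc := fun i : Fin n => Val.nat i)
    (e := foldP (var 4) (var 1) joinP)
    (fun pre g => ∃ D, g = encAsg D ∧ Refines G c (fun i _ => i ∈ pre) D)
    length_allNodes.le runs_var2 hinit
    ⟨_, rfl, by simp [length_allNodes], id, by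
      rintro ⟨i, j⟩
      simp [mem_allNodes, eq_comm], fun x y h => by cases h; rfl, fun u w h => by simp at h⟩
    (by
      rintro pre u suf _ hL ⟨D, rfl, hD⟩
      obtain ⟨g, hg, D', rfl, hD'⟩ := Runs.fold (O := O) (s := s) (b := b) (f := 100)
        (l := var 4) (i := var 1) (e := joinP)
        (x := .pair (.nat u) (.pair (encAsg D) (.pair (encAsg E) (.pair (encRows G)
          (.pair (encNodes (allNodes n)) r)))))
        (enc := fun i : Fin n => Val.nat i)
        (fun pre' g => ∃ D, g = encAsg D ∧
          Refines G c (fun i j => i ∈ pre ∨ (i = u ∧ j ∈ pre')) D)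
        length_allNodes.le runs_var4 runs_var1 ⟨D, rfl, by simpa using hD⟩
        (by
          rintro pre' w suf' _ hL' ⟨D, rfl, hD⟩
          obtain ⟨D', hrun, hD'⟩ := runs_joinP (O := O) (s := s) (b := b) hE hElen hD
          refine ⟨_, hrun, D', rfl, ?_⟩
          convert hD' using 3
          simp only [List.mem_append, List.mem_singleton]
          tauto)
      refine ⟨_, hg.mono (by decide), D', rfl, ?_⟩
      convert hD' using 3
      simp [mem_allNodes])
  refine ⟨D, d, hg.mono (by decide), hDlen, hDd, fun x y => ⟨hreach x y, ?_⟩⟩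
  rintro ⟨w⟩
  induction w with
  | nil => rfl
  | cons hadj w ih => exact (hS _ _ (mem_allNodes _) hadj).trans ih

/-- On an environment that starts with a labelling, with the list of all nodes in place 3, list the
blocks. -/
def blocksP : Prog :=
  mapP (var 3) (selP (var 2) (eqP (sndP (var 0)) (labelP (var 4) (var 2))) (fstP (var 0)))

/-- Each node contributes the list of its block; the resulting repetitions vanish because
`decodeFamily` forms a set. -/
theorem runs_blocksP {D : List (Fin n × Fin n)} {d : Fin n → Fin n} {r r' r'' : Val}
    (hD : Represents D d) (hlen : D.length ≤ n) :
    ∃ y, Runs O s b n 110 blocksP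
      (.pair (encAsg D) (.pair r (.pair r' (.pair (encNodes (allNodes n)) r'')))) y ∧
      decodeFamily n y =
        some (Finset.univ.image fun x => Finset.univ.filter fun y => d y = d x) := by
  have h1 : ∀ i, (((D.filter fun q => q.2 = d i).map fun q => Val.nat q.1).reverse) =
      ((D.filter fun q => q.2 = d i).map Prod.fst).reverse.map fun j : Fin n => Val.nat j := by
    intro i
    simp [Function.comp_def]
  refine ⟨_, Runs.mono (Runs.mapP (enc := fun i : Fin n => Val.nat i) (d := 80)
    (fun i => encNodes ((D.filter fun q => q.2 = d i).map Prod.fst).reverse) length_allNodes.le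
    runs_var3 fun i _ r₁ => ?_) (by decide), ?_⟩
  · have h2 := Runs.selP (O := O) (s := s) (b := b) (l := var 2)
      (x := .pair (.nat i) (.pair r₁ (.pair (encAsg D) (.pair r (.pair r'
        (.pair (encNodes (allNodes n)) r''))))))
      (c := eqP (sndP (var 0)) (labelP (var 4) (var 2))) (e := fstP (var 0))
      (fun q : Fin n × Fin n => q.2 = d i) (fun q => Val.nat q.1) (enc := encPair) hlen runs_var2
      (fun q _ r₂ => by
        simp_rw [Fin.ext_iff]
        exact Runs.eqP runs_var_zero.sndP (Runs.labelP hD hlen runs_var4 runs_var2))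
      (fun q _ _ r₂ => runs_var_zero.fstP)
    rw [h1] at h2
    exact h2.mono (by decide)
  · rw [← List.map_reverse, decodeFamily_ofList]
    congr 1
    ext C
    simp only [List.mem_toFinset, List.mem_map, List.mem_reverse, mem_allNodes, true_and,
      Finset.mem_image, Finset.mem_univ]
    refine exists_congr fun i => ?_
    have : ((D.filter fun q => q.2 = d i).map Prod.fst).reverse.toFinset =
        Finset.univ.filter fun y => d y = d i := by
      ext y
      simp only [List.mem_toFinset, List.mem_reverse, List.mem_map, List.mem_filter, hD _,
        decide_eq_true_eq, Finset.mem_filter, Finset.mem_univ, true_and, Prod.exists]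
      constructor
      · rintro ⟨j, l, ⟨rfl, h⟩, rfl⟩
        exact h
      · intro h
        exact ⟨y, _, ⟨rfl, h⟩, rfl⟩
    rw [this]

/-- The list of all nodes of a graph. -/
def nodesP : Prog := foldP (.op .snd) nilP (.fork (countP (var 1)) (var 1))

/-- The rows of the matrix serve as a counter: at each row the length of the list built so far is
put in front of it, whence the decreasing order. -/
theorem runs_nodesP : Runs O s b n 60 nodesP (encodeGraph G) (encNodes (allNodes n)) := by
  classical
  obtain ⟨g, hg, rfl⟩ := Runs.fold (O := O) (s := s) (b := b) (M := n) (f := 25) (l := .op .snd)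
    (i := nilP) (e := .fork (countP (var 1)) (var 1)) (x := encodeGraph G)
    (enc := fun i : Fin n => Val.ofList ((List.finRange n).map fun j =>
      .nat (if G.Adj i j then 1 else 0)))
    (fun pre g => g = Val.ofList (((List.range pre.length).map Val.nat).reverse))
    (L := List.finRange n) (by simp) (.op rfl) runs_nilP rfl
    (by
      rintro pre u suf _ hL rfl
      have hlen : pre.length ≤ n := by
        have := congrArg List.length hL
        simp only [List.length_finRange, List.length_append] at this
        omega
      have h1 := (Runs.countP (O := O) (s := s) (b := b) (l := var 1) (M := n)
        (L := ((List.range pre.length).map Val.nat).reverse)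
        (x := .pair (Val.ofList ((List.finRange n).map fun j => .nat (if G.Adj u j then 1 else 0)))
          (.pair (Val.ofList ((List.range pre.length).map Val.nat).reverse) (encodeGraph G)))
        (by simpa using hlen) runs_var1).fork runs_var1
      refine ⟨_, h1.mono (by decide), ?_⟩
      simp [List.range_succ, Val.ofList])
  have h2 : encNodes (allNodes n) =
      Val.ofList (((List.range (List.finRange n).length).map Val.nat).reverse) := by
    rw [encNodes, allNodes, List.map_reverse]
    congr 2
    apply List.ext_getElem <;> simp
  rw [h2]
  exact hg.mono (by decide)

/-- The complete program, with `p` for finding separations. -/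
def gcsgP (p : Prog) : Prog :=
  .seq (.fork (.op .snd) (.fork nodesP nilP))
    (letP (.seq (.fork (var 0) (.fork (var 1) (.fork nilP (.fork nilP (.fork (var 1)
        (.fork nilP nilP)))))) (.fix (searchP p)))
      (letP refineP blocksP))

/-- The complete program solves the problem if the recursive procedure finds an optimal labelling
of all nodes. -/
theorem solvesWithin_gcsgP (hv : IsIDM G v) (h0 : v ∅ = 0) {T : ℕ} {e : List (Fin n × Fin n)}
    (he : RunsIn (valueOracle v) (searchP p) (searchP p) (encState G [] [] (allNodes n) [])
      (encAsg e) T) (hopt : OptExt v [] (allNodes n) e) :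
    SolvesWithin (gcsgP p) G v (T + cost 0 n 140 : ℕ) := by
  have hlen : e.length ≤ n := by
    have := hopt.perm.length_eq
    rw [List.length_map, length_allNodes] at this
    exact this.le
  have hnodup : (e.map Prod.fst).Nodup := (List.Perm.nodup_iff hopt.perm).2 nodup_allNodes
  have hex : ∀ x, ∃ l, (x, l) ∈ e := by
    intro x
    have : x ∈ e.map Prod.fst := hopt.perm.mem_iff.2 (mem_allNodes x)
    obtain ⟨r, hr, rfl⟩ := List.mem_map.1 this
    exact ⟨r.2, hr⟩
  choose c hc using hex
  have hrep : Represents e c := by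
    rintro ⟨i, j⟩
    constructor
    · intro h
      exact congrArg Prod.snd (List.inj_on_of_nodup_map hnodup h (hc i) rfl)
    · rintro (rfl : j = c i)
      exact hc i
  have hval : asgValue v e = labelValue v c Finset.univ := by
    rw [asgValue_eq_labelValue h0 (c := c)]
    · congr 1
      ext x
      simpa using ⟨c x, hc x⟩
    · intro r hr r' hr'
      rw [(hrep r).1 hr, (hrep r').1 hr']
  have hbest : ∀ c', labelValue v c' Finset.univ ≤ labelValue v c Finset.univ := by
    intro c'
    -- Compatibility with the empty assignment is vacuous, so the optimum is over all labellings.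
    have h1 := hopt.le c' (by intro r hr; simp at hr)
    have h2 : (([] : List (Fin n × Fin n)).map Prod.fst).toFinset ∪ (allNodes n).toFinset =
        Finset.univ := by
      ext x
      simp [mem_allNodes]
    rwa [h2, List.append_nil, hval] at h1
  set r : Val := .pair (encRows G) (.pair (encNodes (allNodes n)) .nil) with hr
  obtain ⟨D, d, hD, hDlen, hDd, hreach⟩ := runs_refineP (O := valueOracle v) (s := gcsgP p)
    (b := 0) (G := G) (r := .nil) hrep hlen
  obtain ⟨y, hy, hdec⟩ := runs_blocksP (O := valueOracle v) (s := gcsgP p) (b := 0)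
    (r := encAsg e) (r' := encRows G) (r'' := .nil) hDd hDlen
  obtain ⟨P, hP, hPopt⟩ := exists_isOptimalCS hv h0 hbest hreach
  have h1 : Runs (valueOracle v) (gcsgP p) 0 n 64 (.fork (.op .snd) (.fork nodesP nilP))
      (encodeGraph G) r :=
    Runs.mono ((Runs.op rfl).fork (runs_nodesP.fork runs_nilP)) (by decide)
  have h2 : Runs (valueOracle v) (gcsgP p) 0 n 20 (.fork (var 0) (.fork (var 1) (.fork nilP
      (.fork nilP (.fork (var 1) (.fork nilP nilP)))))) r
      (encState G [] [] (allNodes n) []) :=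
    Runs.mono (runs_var_zero.fork (runs_var1.fork (runs_nilP.fork (runs_nilP.fork
      (runs_var1.fork (runs_nilP.fork runs_nilP)))))) (by decide)
  have h3 : Runs (valueOracle v) (gcsgP p) 0 n 134 (letP refineP blocksP) (.pair (encAsg e) r) y :=
    Runs.mono (hD.letP hy) (by decide)
  obtain ⟨t, ht, hrun⟩ := RunsIn.seq h1 (RunsIn.seq (RunsIn.fork (RunsIn.seq h2 (RunsIn.fix he))
    RunsIn.skip) h3)
  refine ⟨y, t, hrun, ?_, P, ?_, hPopt⟩
  · have h4 := cost_mono 0 n (show 64 ≤ 134 by decide)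
    have h5 := cost_mono 0 n (show 20 ≤ 134 by decide)
    have h6 := two_pow_mul_cost_le_of 0 n (show 134 + 6 ≤ 140 by decide)
    have h7 := two_pow_le_cost 0 n 134
    exact_mod_cast (by omega : t ≤ T + cost 0 n 140)
  · rw [hdec, hP]

end

/-! ### Growth of the exponent -/

section

variable {f g : ℝ → ℝ} {α β : ℝ} {n : ℕ}

/-- The number of the last level with at least one node. -/
noncomputable def lastLevel (α : ℝ) (n : ℕ) : ℕ := ⌊Real.log n / |Real.log α|⌋₊

/-- After taking logarithms, both sides say i |log α| ≤ log n. -/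
theorem le_lastLevel_iff (hα0 : 0 < α) (hα1 : α < 1) (hn : 1 ≤ n) (i : ℕ) :
    i ≤ lastLevel α n ↔ 1 ≤ α ^ i * n := by
  have hn' : (0 : ℝ) < n := by exact_mod_cast hn
  have hlog : Real.log α < 0 := Real.log_neg hα0 hα1
  have hlogn : 0 ≤ Real.log n := Real.log_natCast_nonneg n
  have hpos : 0 < α ^ i * n := by positivity
  rw [lastLevel, Nat.le_floor_iff (by positivity), abs_of_neg hlog, le_div_iff₀ (by linarith),
    ← Real.log_nonneg_iff hpos, Real.log_mul (by positivity) hn'.ne', Real.log_pow]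
  constructor <;> intro h <;> linarith

/-- The summands of the exponent. -/
noncomputable def levelTerm (f g : ℝ → ℝ) (α : ℝ) (n i : ℕ) : ℝ :=
  2 * Real.log (g (f (α ^ i * n))) + 2 * f (α ^ i * n) *
    Real.log (if i = 0 then f n else ∑ j ∈ Finset.range i, f (α ^ j * n))

theorem h_eq (f g : ℝ → ℝ) (α : ℝ) (n : ℕ) :
    h f g α n = ∑ i ∈ Finset.range (lastLevel α n + 1), levelTerm f g α n i := rfl

/-- Hypotheses on the separator size and on the number of coalition structures. -/
structure Admissible (f g : ℝ → ℝ) : Prop where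
  monotoneOn : MonotoneOn f (Set.Ici 0)
  one_le : 1 ≤ f 1
  nonneg : 0 ≤ f 0
  monotoneOn' : MonotoneOn g (Set.Ici 0)
  one_le' : 1 ≤ g 0

namespace Admissible

theorem mono (hfg : Admissible f g) {x y : ℝ} (hx : 0 ≤ x) (hxy : x ≤ y) : f x ≤ f y :=
  hfg.monotoneOn (Set.mem_Ici.2 hx) (Set.mem_Ici.2 (hx.trans hxy)) hxy

theorem f_nonneg (hfg : Admissible f g) {x : ℝ} (hx : 0 ≤ x) : 0 ≤ f x :=
  hfg.nonneg.trans (hfg.mono le_rfl hx)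

theorem one_le_f (hfg : Admissible f g) {x : ℝ} (hx : 1 ≤ x) : 1 ≤ f x :=
  hfg.one_le.trans (hfg.mono zero_le_one hx)

theorem one_le_g (hfg : Admissible f g) {x : ℝ} (hx : 0 ≤ x) : 1 ≤ g x :=
  hfg.one_le'.trans (hfg.monotoneOn' (Set.mem_Ici.2 le_rfl) (Set.mem_Ici.2 hx) hx)

theorem log_g_nonneg (hfg : Admissible f g) {x : ℝ} (hx : 0 ≤ x) : 0 ≤ Real.log (g (f x)) :=
  Real.log_nonneg (hfg.one_le_g (hfg.f_nonneg hx))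

theorem term_le_term (hfg : Admissible f g) {x x' y y' : ℝ} (hx : 0 ≤ x) (hxx' : x ≤ x')
    (hy : 1 ≤ y) (hyy' : y ≤ y') : 2 * Real.log (g (f x)) + 2 * f x * Real.log y ≤
      2 * Real.log (g (f x')) + 2 * f x' * Real.log y' := by
  have h1 := hfg.mono hx hxx'
  have h0 := hfg.f_nonneg hx
  have h2 : g (f x) ≤ g (f x') :=
    hfg.monotoneOn' (Set.mem_Ici.2 h0) (Set.mem_Ici.2 (h0.trans h1)) h1
  have h3 : Real.log (g (f x)) ≤ Real.log (g (f x')) :=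
    Real.log_le_log (by linarith [hfg.one_le_g h0]) h2
  have h4 : Real.log y ≤ Real.log y' := Real.log_le_log (by linarith) hyy'
  have h5 := Real.log_nonneg hy
  have h6 : f x * Real.log y ≤ f x' * Real.log y' := mul_le_mul h1 h4 h5 (h0.trans h1)
  linarith

/-- On the levels with at least one node, the argument of the last logarithm is at least one, and
at least the number of the level. -/
theorem one_le_inner (hfg : Admissible f g) (hα0 : 0 < α) (hα1 : α < 1) (hn : 1 ≤ n) {i : ℕ}
    (hi : 1 ≤ α ^ i * n) :
    1 ≤ (if i = 0 then f n else ∑ j ∈ Finset.range i, f (α ^ j * n)) ∧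
      (i : ℝ) ≤ (if i = 0 then f n else ∑ j ∈ Finset.range i, f (α ^ j * n)) := by
  by_cases h0 : i = 0
  · subst h0
    have : 1 ≤ f n := hfg.one_le_f (by exact_mod_cast hn)
    simp only [if_true, Nat.cast_zero]
    exact ⟨this, by linarith⟩
  · rw [if_neg h0]
    have h1 : ∑ j ∈ Finset.range i, (1 : ℝ) ≤ ∑ j ∈ Finset.range i, f (α ^ j * n) := by
      refine Finset.sum_le_sum fun j hj => hfg.one_le_f (hi.trans ?_)
      exact mul_le_mul_of_nonneg_right
        (pow_le_pow_of_le_one hα0.le hα1.le (Finset.mem_range.1 hj).le) (Nat.cast_nonneg n)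
    rw [Finset.sum_const, Finset.card_range, nsmul_eq_mul, mul_one] at h1
    have h2 : (1 : ℝ) ≤ i := by exact_mod_cast Nat.one_le_iff_ne_zero.2 h0
    exact ⟨h2.trans h1, h1⟩

theorem levelTerm_nonneg (hfg : Admissible f g) (hα0 : 0 < α) (hα1 : α < 1) (hn : 1 ≤ n) {i : ℕ}
    (hi : 1 ≤ α ^ i * n) : 0 ≤ levelTerm f g α n i := by
  have h1 := hfg.log_g_nonneg (x := α ^ i * n) (by positivity)
  have h2 := Real.log_nonneg (hfg.one_le_inner hα0 hα1 hn hi).1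
  have h3 := hfg.f_nonneg (x := α ^ i * n) (by positivity)
  unfold levelTerm
  positivity

/-- Level k of the smaller graph is compared with level k + i of the larger one. The case i = 0
serves for enlarging the constant, the case α = β for passing to a subgraph. -/
theorem levelTerm_le_levelTerm (hfg : Admissible f g) (hα0 : 0 < α) (hα1 : α < 1) (hαβ : α ≤ β)
    (hβ1 : β ≤ 1) {m : ℕ} (hm : 1 ≤ m) {i k : ℕ} (hmn : (m : ℝ) ≤ β ^ i * n) (hk : 1 ≤ α ^ k * m) :
    levelTerm f g α m k ≤ levelTerm f g β n (k + i) := by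
  have hβ0 : 0 < β := hα0.trans_le hαβ
  have key : ∀ j, α ^ j * m ≤ β ^ (j + i) * n := by
    intro j
    calc α ^ j * m ≤ β ^ j * (β ^ i * n) :=
          mul_le_mul (pow_le_pow_left₀ hα0.le hαβ j) hmn (Nat.cast_nonneg m) (by positivity)
      _ = _ := by ring
  refine hfg.term_le_term (by positivity) (key k) (hfg.one_le_inner hα0 hα1 hm hk).1 ?_
  have hsum : ∑ j ∈ Finset.range k, f (α ^ j * m) ≤
      ∑ j ∈ Finset.range k, f (β ^ (j + i) * n) :=
    Finset.sum_le_sum fun j _ => hfg.mono (by positivity) (key j)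
  by_cases hi : i = 0
  · subst hi
    by_cases hk0 : k = 0
    · subst hk0
      simpa using hfg.mono (Nat.cast_nonneg m) (by simpa using hmn)
    · simpa [hk0] using hsum
  · have hnn : ∀ j, 0 ≤ f (β ^ j * n) := fun j => hfg.f_nonneg (by positivity)
    rw [if_neg (by omega : k + i ≠ 0)]
    -- For k = 0 the convention replaces the inner sum of the smaller graph by f(m), which is at
    -- most f(n), the first summand of the inner sum on the right.
    by_cases hk0 : k = 0
    · subst hk0
      rw [if_pos rfl, zero_add]
      refine le_trans ?_ (Finset.single_le_sum (fun j _ => hnn j)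
        (Finset.mem_range.2 (Nat.pos_of_ne_zero hi)))
      refine hfg.mono (Nat.cast_nonneg m) (hmn.trans ?_)
      exact mul_le_mul_of_nonneg_right (pow_le_pow_of_le_one hβ0.le hβ1 (Nat.zero_le i))
        (Nat.cast_nonneg n)
    · rw [if_neg hk0, add_comm k i, Finset.sum_range_add]
      refine hsum.trans ?_
      simp_rw [add_comm _ i]
      exact le_add_of_nonneg_left (Finset.sum_nonneg fun j _ => hnn j)

/-- The exponent of a smaller graph is at most the sum of the later terms. -/
theorem h_le_sum_Ico (hfg : Admissible f g) (hα0 : 0 < α) (hα1 : α < 1) {m : ℕ} (hm : 1 ≤ m)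
    (hn : 1 ≤ n) {i : ℕ} (hmn : (m : ℝ) ≤ α ^ i * n) :
    h f g α m ≤ ∑ k ∈ Finset.Ico i (lastLevel α n + 1), levelTerm f g α n k := by
  have hlev : lastLevel α m + i ≤ lastLevel α n := by
    rw [le_lastLevel_iff hα0 hα1 hn]
    have := (le_lastLevel_iff hα0 hα1 hm _).1 le_rfl
    calc 1 ≤ α ^ lastLevel α m * m := this
      _ ≤ α ^ lastLevel α m * (α ^ i * n) := mul_le_mul_of_nonneg_left hmn (by positivity)
      _ = _ := by ring
  rw [h_eq, Finset.sum_Ico_eq_sum_range]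
  refine (Finset.sum_le_sum (g := fun k => levelTerm f g α n (i + k)) fun k hk => ?_).trans
    (Finset.sum_le_sum_of_subset_of_nonneg (Finset.range_mono (by omega)) fun k hk _ => ?_)
  · rw [add_comm i k]
    exact hfg.levelTerm_le_levelTerm hα0 hα1 le_rfl hα1.le hm hmn
      ((le_lastLevel_iff hα0 hα1 hm k).1 (by have := Finset.mem_range.1 hk; omega))
  · exact hfg.levelTerm_nonneg hα0 hα1 hn
      ((le_lastLevel_iff hα0 hα1 hn _).1 (by have := Finset.mem_range.1 hk; omega))

/-- The number of labellings of a separator. -/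
theorem ascFactorial_le (hfg : Admissible f g) (hα0 : 0 < α) (hα1 : α < 1) (hn : 1 ≤ n)
    {i k r : ℕ} (hi : 1 ≤ α ^ i * n) (hk : (k : ℝ) ≤ ∑ j ∈ Finset.range i, f (α ^ j * n))
    (hr : (r : ℝ) ≤ f (α ^ i * n)) :
    ((k + 1).ascFactorial r : ℝ) ≤ 2 * Real.exp (levelTerm f g α n i) := by
  have hx1 : 1 ≤ f (α ^ i * n) := hfg.one_le_f hi
  have hlog := hfg.log_g_nonneg (x := α ^ i * n) (by positivity)
  have hterm := hfg.levelTerm_nonneg hα0 hα1 hn hi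
  have hasc : ((k + 1).ascFactorial r : ℝ) ≤ ((k : ℝ) + r) ^ r := by
    exact_mod_cast Nat.ascFactorial_le_pow_add k r
  refine hasc.trans ?_
  have hpow : ∀ y : ℝ, 1 ≤ y → y ^ r ≤ Real.exp (f (α ^ i * n) * Real.log y) := by
    intro y hy
    rw [← Real.exp_log (show (0 : ℝ) < y ^ r by positivity), Real.log_pow, Real.exp_le_exp]
    exact mul_le_mul_of_nonneg_right hr (Real.log_nonneg hy)
  have hone : (1 : ℝ) ≤ Real.exp (levelTerm f g α n i) := Real.one_le_exp hterm
  -- At the top level nothing is labelled yet; the count is at most r^r ≤ f(n)^r, in agreement with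
  -- reading the empty inner sum as f(n).
  by_cases h0 : i = 0
  · subst h0
    have hk0 : k = 0 := by
      have : (k : ℝ) ≤ 0 := by simpa using hk
      exact_mod_cast le_antisymm this (Nat.cast_nonneg k)
    subst hk0
    simp only [pow_zero, one_mul] at hx1 hr hlog hpow
    have h1 : ((0 : ℕ) + (r : ℝ)) ^ r ≤ f n ^ r := by
      rw [Nat.cast_zero, zero_add]
      exact pow_le_pow_left₀ (Nat.cast_nonneg r) hr r
    have h2 : Real.exp (f n * Real.log (f n)) ≤ Real.exp (levelTerm f g α n 0) := by
      rw [Real.exp_le_exp, levelTerm]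
      simp only [pow_zero, one_mul, if_true]
      have : 0 ≤ f n * Real.log (f n) := mul_nonneg (by linarith) (Real.log_nonneg hx1)
      linarith
    have := hpow _ hx1
    linarith
  · set y := ∑ j ∈ Finset.range i, f (α ^ j * n) with hy
    have hxy : f (α ^ i * n) ≤ y := by
      refine le_trans ?_ (Finset.single_le_sum (f := fun j => f (α ^ j * n))
        (fun j _ => hfg.f_nonneg (by positivity))
        (Finset.mem_range.2 (Nat.pos_of_ne_zero h0)))
      exact hfg.mono (by positivity) (mul_le_mul_of_nonneg_right
        (pow_le_pow_of_le_one hα0.le hα1.le (Nat.zero_le i)) (Nat.cast_nonneg n))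
    -- Here k + r ≤ 2y ≤ y², and the square is paid for by the factor 2 in front of f in the
    -- exponent. If y < 2, then k and r are at most 1 and the count is at most 2, which explains the
    -- factor 2 in the claim.
    by_cases hy2 : 2 ≤ y
    · have h1 : ((k : ℝ) + r) ^ r ≤ (y ^ 2) ^ r :=
        pow_le_pow_left₀ (by positivity) (by nlinarith) r
      have h2 := hpow (y ^ 2) (by nlinarith)
      have h3 : Real.exp (f (α ^ i * n) * Real.log (y ^ 2)) ≤
          Real.exp (levelTerm f g α n i) := by
        rw [Real.exp_le_exp, levelTerm, if_neg h0, Real.log_pow, ← hy]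
        push_cast
        linarith
      linarith
    · have hk1 : k ≤ 1 := by
        have : (k : ℝ) < 2 := by linarith
        have : k < 2 := by exact_mod_cast this
        omega
      have hr1 : r ≤ 1 := by
        have : (r : ℝ) < 2 := by linarith
        have : r < 2 := by exact_mod_cast this
        omega
      have h1 : (k + r) ^ r ≤ 2 := by
        interval_cases k <;> interval_cases r <;> norm_num
      have h2 : ((k : ℝ) + r) ^ r ≤ 2 := by exact_mod_cast h1
      linarith

/-- A larger constant makes up for any polynomial factor. -/
theorem exists_h_add_le (hα0 : 0 < α) (hαβ : α < β) (hβ1 : β < 1) {c : ℝ} (hc : 0 ≤ c) :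
    ∃ K : ℝ, ∀ f g : ℝ → ℝ, Admissible f g → ∀ n : ℕ, 1 ≤ n →
      h f g α n + c * Real.log n ≤ h f g β n + K := by
  have hβ0 : 0 < β := hα0.trans hαβ
  have hα1 : α < 1 := hαβ.trans hβ1
  have hlα : 0 < |Real.log α| := abs_pos.2 (Real.log_neg hα0 hα1).ne
  have hlβ : 0 < |Real.log β| := abs_pos.2 (Real.log_neg hβ0 hβ1).ne
  have hll : |Real.log β| < |Real.log α| := by
    rw [abs_of_neg (Real.log_neg hα0 hα1), abs_of_neg (Real.log_neg hβ0 hβ1)]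
    have := Real.log_lt_log hα0 hαβ
    linarith
  -- The constant β gives at least δ log n - 1 more levels than α. The threshold a = c/δ is such
  -- that extra summands of size 2a contribute 2c log n - 2a.
  set δ := 1 / |Real.log β| - 1 / |Real.log α| with hδ
  have hδ0 : 0 < δ := sub_pos.2 (one_div_lt_one_div_of_lt hlβ hll)
  set a := c / δ with ha
  have ha0 : 0 ≤ a := by positivity
  refine ⟨2 * a + c * (|Real.log α| * Real.exp a), fun f g hfg n hn => ?_⟩
  have hlogn : 0 ≤ Real.log n := Real.log_natCast_nonneg n
  have hla : (lastLevel α n : ℝ) ≤ Real.log n / |Real.log α| := Nat.floor_le (by positivity)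
  have hla' : Real.log n / |Real.log α| < lastLevel α n + 1 := Nat.lt_floor_add_one _
  have hlb' : Real.log n / |Real.log β| < lastLevel β n + 1 := Nat.lt_floor_add_one _
  have hlev : lastLevel α n ≤ lastLevel β n :=
    Nat.floor_mono (div_le_div_of_nonneg_left hlogn hlβ hll.le)
  have hgap : δ * Real.log n - 1 ≤ (lastLevel β n : ℝ) - lastLevel α n := by
    have : δ * Real.log n = Real.log n / |Real.log β| - Real.log n / |Real.log α| := by
      rw [hδ]; ring
    linarith
  have hgap0 : (0 : ℝ) ≤ (lastLevel β n : ℝ) - lastLevel α n :=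
    sub_nonneg.2 (by exact_mod_cast hlev)
  have hsplit : h f g β n = ∑ i ∈ Finset.range (lastLevel α n + 1), levelTerm f g β n i +
      ∑ i ∈ Finset.Ico (lastLevel α n + 1) (lastLevel β n + 1), levelTerm f g β n i := by
    rw [h_eq, Finset.sum_range_add_sum_Ico _ (by omega)]
  have hfst : h f g α n ≤ ∑ i ∈ Finset.range (lastLevel α n + 1), levelTerm f g β n i := by
    rw [h_eq]
    refine Finset.sum_le_sum fun i hi => ?_
    exact hfg.levelTerm_le_levelTerm (i := 0) hα0 hα1 hαβ.le hβ1.le hn (by simp)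
      ((le_lastLevel_iff hα0 hα1 hn i).1 (by have := Finset.mem_range.1 hi; omega))
  have hlogpos : 0 ≤ Real.log (lastLevel α n + 1 : ℕ) := Real.log_natCast_nonneg _
  -- On an extra level the inner sum is at least the level number, because each of its terms is at
  -- least 1; the outer factor f is also at least 1.
  have hsnd : ((lastLevel β n : ℝ) - lastLevel α n) * (2 * Real.log (lastLevel α n + 1 : ℕ)) ≤
      ∑ i ∈ Finset.Ico (lastLevel α n + 1) (lastLevel β n + 1), levelTerm f g β n i := by
    have hterm : ∀ i ∈ Finset.Ico (lastLevel α n + 1) (lastLevel β n + 1),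
        2 * Real.log (lastLevel α n + 1 : ℕ) ≤ levelTerm f g β n i := by
      intro i hi
      obtain ⟨hi1, hi2⟩ := Finset.mem_Ico.1 hi
      have hi3 := (le_lastLevel_iff hβ0 hβ1 hn i).1 (by omega)
      have h1 := (hfg.one_le_inner hβ0 hβ1 hn hi3).2
      have h2 : Real.log (lastLevel α n + 1 : ℕ) ≤
          Real.log (if i = 0 then f n else ∑ j ∈ Finset.range i, f (β ^ j * n)) :=
        Real.log_le_log (by positivity) (le_trans (by exact_mod_cast hi1) h1)
      have h3 := hfg.one_le_f hi3
      have h4 := hfg.log_g_nonneg (x := β ^ i * n) (by positivity)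
      rw [levelTerm]
      nlinarith
    have := Finset.card_nsmul_le_sum _ _ _ hterm
    rw [Nat.card_Ico, nsmul_eq_mul, Nat.cast_sub (by omega)] at this
    push_cast at this ⊢
    linarith
  by_cases hbig : a ≤ Real.log (lastLevel α n + 1 : ℕ)
  · have h1 : (δ * Real.log n - 1) * (2 * a) ≤
        ((lastLevel β n : ℝ) - lastLevel α n) * (2 * Real.log (lastLevel α n + 1 : ℕ)) :=
      (mul_le_mul_of_nonneg_right hgap (by positivity)).trans
        (mul_le_mul_of_nonneg_left (by linarith) hgap0)
    have h2 : δ * Real.log n * (2 * a) = 2 * (c * Real.log n) := by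
      rw [ha]
      field_simp
    have h3 : 0 ≤ c * Real.log n := by positivity
    have h4 : 0 ≤ c * (|Real.log α| * Real.exp a) := by positivity
    linarith
  -- Otherwise the number of levels is bounded, hence so is log n, and a constant suffices.
  · have h1 : ((lastLevel α n + 1 : ℕ) : ℝ) ≤ Real.exp a :=
      ((Real.log_lt_iff_lt_exp (by positivity)).1 (not_le.1 hbig)).le
    have h2 : Real.log n ≤ |Real.log α| * Real.exp a := by
      rw [div_lt_iff₀ hlα] at hla'
      push_cast at h1
      nlinarith
    have h3 := mul_le_mul_of_nonneg_left h2 hc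
    have h4 := mul_nonneg hgap0 (mul_nonneg zero_le_two hlogpos)
    linarith

end Admissible

end

/-! ### Admissibility of the data, and solution of the recurrence. -/

section

variable {n : ℕ} {G : SimpleGraph (Fin n)}

theorem GraphClass.SubgraphClosed.listGraph_mem {S : GraphClass} (hS : S.SubgraphClosed)
    (hG : G ∈ S n) {W : List (Fin n)} (hW : W.Nodup) : listGraph G W ∈ S W.length :=
  hS _ _ _ G hG (SimpleGraph.Embedding.comap ⟨embed W, embed_injective hW⟩ G).isContained

/-- A single node must lie in the separator: a side containing it would have 1 ≤ α nodes. -/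
theorem one_le_of_isSeparation {f : ℝ → ℝ} {α : ℝ} (hα1 : α < 1) {H : SimpleGraph (Fin 1)}
    {A B : H.Subgraph} (h : IsSeparation f α H A B) : 1 ≤ f 1 := by
  obtain ⟨hcover, hAB, hA, hB⟩ := h
  simp only [Nat.cast_one, mul_one] at hAB hA hB
  have h0 : (0 : Fin 1) ∈ (A ⊔ B).verts := by rw [hcover]; simp
  have hncard : ∀ s : Set (Fin 1), 0 ∈ s → (1 : ℝ) ≤ s.ncard := by
    intro s hs
    exact_mod_cast (Set.ncard_pos s.toFinite).2 ⟨0, hs⟩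
  by_cases hA0 : (0 : Fin 1) ∈ A.verts
  · by_cases hB0 : (0 : Fin 1) ∈ B.verts
    · exact (hncard (A.verts ∩ B.verts) ⟨hA0, hB0⟩).trans hAB
    · linarith [hncard (A.verts \ B.verts) ⟨hA0, hB0⟩]
  · have hB0 : (0 : Fin 1) ∈ B.verts := by
      rw [SimpleGraph.Subgraph.verts_sup] at h0
      exact h0.resolve_left hA0
    linarith [hncard (B.verts \ A.verts) ⟨hB0, hA0⟩]

theorem one_le_numConnectedCS_zero (H : SimpleGraph (Fin 0)) : 1 ≤ numConnectedCS H := by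
  have : Nonempty {P : CoalitionStructure 0 // IsConnectedCS H P} := by
    refine ⟨⟨(Finpartition.empty _).copy (by simp), ?_⟩⟩
    intro C hC
    simp at hC
  exact Nat.one_le_iff_ne_zero.2 (Nat.card_ne_zero.2 ⟨this, inferInstance⟩)

/-- A nonempty graph of S has subgraphs with one node and with none. Their separators bound f(1) and
f(0) from below, and the empty graph has a connected coalition structure. -/
theorem admissible {S : GraphClass} {f g : ℝ → ℝ} {α : ℝ} (hS : S.SubgraphClosed)
    (hg : MonotoneOn g (Set.Ici 0))
    (hcount : ∀ (n : ℕ) (G : SimpleGraph (Fin n)), G ∈ S n → (numConnectedCS G : ℝ) ≤ g n)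
    (hf : MonotoneOn f (Set.Ici 0)) (hα1 : α < 1) (hsep : S.SeparatorTheorem f α)
    (hG : G ∈ S n) (hn : 1 ≤ n) : Admissible f g where
  monotoneOn := hf
  monotoneOn' := hg
  one_le := by
    have h1 : listGraph G [⟨0, hn⟩] ∈ S 1 :=
      hS.listGraph_mem (W := [⟨0, hn⟩]) hG (List.nodup_singleton _)
    obtain ⟨A, B, h⟩ := hsep 1 _ h1
    exact one_le_of_isSeparation hα1 h
  nonneg := by
    have h0 : listGraph G [] ∈ S 0 := hS.listGraph_mem hG List.nodup_nil
    obtain ⟨A, B, h⟩ := hsep 0 _ h0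
    exact le_trans (Nat.cast_nonneg _) (by simpa using h.2.1)
  one_le' := by
    have h0 : listGraph G [] ∈ S 0 := hS.listGraph_mem hG List.nodup_nil
    have h1 := hcount 0 _ h0
    have h2 : (1 : ℝ) ≤ numConnectedCS (listGraph G []) := by
      exact_mod_cast one_le_numConnectedCS_zero _
    simpa using h2.trans h1

theorem cast_cost (b n k : ℕ) : (cost b n k : ℝ) = (b + 1) * cost 0 n k := by
  simp [cost]

theorem cast_cost_zero (n k : ℕ) : (cost 0 n k : ℝ) = Real.exp (k * Real.log (n + 2)) := by
  rw [mul_comm, Real.exp_mul, Real.exp_log (by positivity), Real.rpow_natCast]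
  simp [cost]

/-- The recursive procedure takes time `exp (h f g α n)`, up to a polynomial factor. -/
theorem exists_runs_searchP {v : Finset (Fin n) → ℝ} (hv : IsIDM G v) (h0 : v ∅ = 0) {p : Prog}
    {f g : ℝ → ℝ} {α C : ℝ} {σ : ℕ → ℝ} (hfg : Admissible f g) (hα0 : 0 < α) (hα1 : α < 1)
    (hn : 1 ≤ n) (hC : 0 ≤ C)
    (hfind : ∀ W : List (Fin n), W.Nodup → FindsSeparationWithin p f α (listGraph G W) (σ W.length))
    (hσ0 : σ 0 ≤ C) (hσ : ∀ m, σ m ≤ C * Real.exp (h f g α m)) :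
    ∃ (T : ℕ) (e : List (Fin n × Fin n)),
      RunsIn (valueOracle v) (searchP p) (searchP p) (encState G [] [] (allNodes n) [])
        (encAsg e) T ∧ OptExt v [] (allNodes n) e ∧
      (T : ℝ) ≤ (C + 1) * cost 0 n 134 * 13 ^ (lastLevel α n + 2) * Real.exp (h f g α n) := by
  set N := lastLevel α n + 1 with hNdef
  set t : ℕ → ℝ := levelTerm f g α n with ht
  set R : ℕ → ℝ := fun i => Real.exp (∑ k ∈ Finset.Ico i N, t k) with hR
  set Q : ℝ := (C + 1) * cost 0 n 134 with hQ
  -- Ansatz for the recurrence: R i collects the summands of the exponent from level i on, Q the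
  -- polynomial overhead and the constant of the separation time, and each level costs a factor 13.
  set V : ℕ → ℝ := fun i => Q * 13 ^ (N + 1 - i) * R i with hVdef
  set U : ℕ → ℝ := fun i => if i < N then 2 * Real.exp (t i) * (V (i + 1) + Q) else 0 with hUdef
  have hlevel : ∀ i < N, 1 ≤ α ^ i * n := fun i hi =>
    (le_lastLevel_iff hα0 hα1 hn i).1 (by omega)
  have ht0 : ∀ i < N, 0 ≤ t i := fun i hi => hfg.levelTerm_nonneg hα0 hα1 hn (hlevel i hi)
  have hR1 : ∀ i, 1 ≤ R i := fun i => Real.one_le_exp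
    (Finset.sum_nonneg fun k hk => ht0 k (Finset.mem_Ico.1 hk).2)
  have hRsucc : ∀ i < N, Real.exp (t i) * R (i + 1) = R i := by
    intro i hi
    simp only [hR]
    rw [← Real.exp_add, ← Finset.sum_eq_sum_Ico_succ_bot hi]
  have hcost : ∀ k ≤ 134, (cost 0 n k : ℝ) ≤ Q := by
    intro k hk
    have h1 : (cost 0 n k : ℝ) ≤ cost 0 n 134 := by exact_mod_cast cost_mono 0 n hk
    rw [hQ, add_mul, one_mul]
    exact h1.trans (le_add_of_nonneg_left (by positivity))
  have hQ0 : 0 ≤ Q := by positivity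
  have hV0 : ∀ i, 0 ≤ V i := fun i => by
    have := hR1 i
    positivity
  have hU0 : ∀ i, 0 ≤ U i := by
    intro i
    simp only [hUdef]
    split
    · have := hV0 (i + 1)
      positivity
    · exact le_rfl
  obtain ⟨e, he, hopt⟩ := runs_searchP_level (p := p) (G := G) hv h0 hα0.le hfg.monotoneOn hfind
    (N := N) (D := fun i => ∑ j ∈ Finset.range i, f (α ^ j * n)) (P := fun i => Q * R i) (U := U)
    (V := V)
    -- N is the first level at which the size bound is below one node.
    (by
      by_contra hcon
      have := (le_lastLevel_iff hα0 hα1 hn N).2 (not_lt.1 hcon)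
      omega)
    (fun i _ => by rw [Finset.sum_range_succ])
    (by
      intro i hi m τ hm hτ
      -- The empty graph needs the separate bound on σ 0, since h(α, 0) may be negative, namely if 0
      -- < f(0) < 1.
      have h1 : σ m ≤ C * R i := by
        rcases Nat.eq_zero_or_pos m with rfl | hm0
        · exact hσ0.trans (le_mul_of_one_le_right hC (hR1 i))
        · refine (hσ m).trans (mul_le_mul_of_nonneg_left ?_ hC)
          exact Real.exp_le_exp.2 (hfg.h_le_sum_Ico hα0 hα1 hm0 hn hm)
      have h3 : (τ : ℝ) + 1 ≤ (C + 1) * R i := by linarith [hR1 i]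
      rw [cast_cost, hQ]
      calc ((τ : ℝ) + 1) * cost 0 n 134 ≤ (C + 1) * R i * cost 0 n 134 :=
            mul_le_mul_of_nonneg_right h3 (Nat.cast_nonneg _)
        _ = _ := by ring)
    (fun i _ => hU0 i) (fun i _ => hV0 i)
    (by
      intro i hi k r hk hr hrn
      simp only [hUdef, if_pos hi]
      have h1 : (r : ℝ) * cost 0 n 130 ≤ Q := by
        refine le_trans ?_ (hcost (1 + 130) (by norm_num))
        rw [← cost_mul_cost_zero]
        exact_mod_cast Nat.mul_le_mul_right _ (le_cost_one hrn)
      have h4 := hV0 (i + 1)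
      exact mul_le_mul (hfg.ascFactorial_le hα0 hα1 hn (hlevel i hi) hk hr) (by linarith)
        (by positivity) (by positivity))
    (by
      intro i hi
      have h1 := hcost 20 (by norm_num)
      have h2 := hR1 i
      have h3 : Q ≤ Q * R i := le_mul_of_one_le_right hQ0 h2
      -- With X = Q · 13^(N-i) · R i, the terms are 2U ≤ 8X, 2P ≤ 2X and the overhead at most X, so
      -- 11X in total, below 13X. At level N only 2P and the overhead remain.
      rcases hi.lt_or_eq with hi | hi
      · have h4 : U i = 2 * (Q * 13 ^ (N - i) * R i) + 2 * (Q * Real.exp (t i)) := by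
          simp only [hUdef, if_pos hi, hVdef]
          rw [show N + 1 - (i + 1) = N - i by omega, ← hRsucc i hi]
          ring
        have h5 : Real.exp (t i) ≤ R i := by
          rw [← hRsucc i hi]
          exact le_mul_of_one_le_right (Real.exp_pos _).le (hR1 _)
        have h6 : Q * Real.exp (t i) ≤ Q * R i := mul_le_mul_of_nonneg_left h5 hQ0
        have h7 : (1 : ℝ) ≤ 13 ^ (N - i) := one_le_pow₀ (by norm_num)
        have h8 : Q * R i ≤ Q * 13 ^ (N - i) * R i := by
          have h9 : 0 ≤ Q * R i := by positivity
          calc Q * R i ≤ Q * R i * 13 ^ (N - i) := le_mul_of_one_le_right h9 h7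
            _ = _ := by ring
        have h10 : V i = 13 * (Q * 13 ^ (N - i) * R i) := by
          simp only [hVdef]
          rw [show N + 1 - i = N - i + 1 by omega, pow_succ]
          ring
        rw [h4, h10]
        linarith
      · have h4 : U i = 0 := by simp [hUdef, hi]
        have h5 : V i = 13 * (Q * R i) := by
          simp only [hVdef]
          rw [show N + 1 - i = 1 by omega]
          ring
        rw [h4, h5]
        linarith)
    -- The whole graph enters as one side at level 0, with nothing labelled and the other side
    -- empty.
    N 0 (by omega) [] (allNodes n) []
    ⟨by simpa using nodup_allNodes, by simp⟩ (by simp) (by simp [length_allNodes]) (by simp)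
    (by simp)
  refine ⟨_, e, he, by simpa using hopt, (Nat.floor_le (hV0 0)).trans (le_of_eq ?_)⟩
  simp only [hVdef, hR]
  rw [Nat.sub_zero, ← Finset.range_eq_Ico]
  rfl

end

end GCSG

/-! ### The main theorem: absorbing the overhead into the larger constant. -/

theorem theorem1 (S : GCSG.GraphClass) (f g : ℝ → ℝ) (α : ℝ)
    (hS : S.SubgraphClosed)
    (hg : MonotoneOn g (Set.Ici 0))
    (hcount : ∀ (n : ℕ) (G : SimpleGraph (Fin n)), G ∈ S n →
      (GCSG.numConnectedCS G : ℝ) ≤ g n)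
    (hf : MonotoneOn f (Set.Ici 0))
    (hfo : Asymptotics.IsLittleO Filter.atTop f (fun x : ℝ => x))
    (hα0 : 0 < α) (hα1 : α < 1)
    (hsep : S.SeparatorTheorem f α)
    (hfind : ∃ (p : GCSG.Prog) (s : ℕ → ℝ),
      (∀ (n : ℕ) (G : SimpleGraph (Fin n)), G ∈ S n →
        GCSG.FindsSeparationWithin p f α G (s n)) ∧
      Asymptotics.IsLittleO Filter.atTop s (fun n : ℕ => Real.exp (GCSG.h f g α n)))
    (β : ℝ) (hαβ : α < β) (hβ1 : β < 1) :
    ∃ (p : GCSG.Prog) (K : ℝ), ∀ (n : ℕ) (G : SimpleGraph (Fin n)) (v : Finset (Fin n) → ℝ),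
      G ∈ S n → G.Connected → v ∅ = 0 → GCSG.IsIDM G v →
        GCSG.SolvesWithin p G v (K * Real.exp (GCSG.h f g β n)) := by
  obtain ⟨p, σ, hp, hσ⟩ := hfind
  obtain ⟨C₀, hC₀, hbound⟩ := Asymptotics.bound_of_isBigO_nat_atTop hσ.isBigO
  -- Because exponentials do not vanish, the asymptotic bound holds for all m with one constant; |σ
  -- 0| is added to cover σ 0 by the constant alone.
  have hσ' : ∀ m, σ m ≤ (C₀ + |σ 0|) * Real.exp (GCSG.h f g α m) := by
    intro m
    have h1 := hbound (x := m) (Real.exp_pos _).ne'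
    rw [Real.norm_eq_abs, Real.norm_eq_abs, abs_of_pos (Real.exp_pos _)] at h1
    have h2 := (le_abs_self (σ m)).trans h1
    have h3 : 0 ≤ |σ 0| * Real.exp (GCSG.h f g α m) := by positivity
    linarith
  set C := C₀ + |σ 0| with hC
  have hC0 : 0 ≤ C := by positivity
  have hσ0 : σ 0 ≤ C := by
    have := le_abs_self (σ 0)
    linarith
  have hlα : 0 < |Real.log α| := abs_pos.2 (Real.log_neg hα0 hα1).ne
  -- The overhead is (n+2)^140 times 13^(levels + 2), and 13 to the power log n / |log α| equals n
  -- to the power log 13 / |log α|.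
  set c : ℝ := 140 + Real.log 13 / |Real.log α| with hc
  have hc0 : 0 ≤ c := by positivity
  -- K must be fixed before any graph is given, whereas admissibility of f and g is derived from a
  -- nonempty graph in S; therefore K is uniform in f and g.
  obtain ⟨K, hK⟩ := GCSG.Admissible.exists_h_add_le hα0 hαβ hβ1 hc0
  refine ⟨GCSG.gcsgP p, (C + 2) * Real.exp (140 * Real.log 3 + 2 * Real.log 13 + K),
    fun n G v hG hconn h0 hv => ?_⟩
  have hn : 1 ≤ n := by
    obtain ⟨x⟩ := hconn.nonempty
    exact x.pos
  have hfg := GCSG.admissible hS hg hcount hf hα1 hsep hG hn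
  obtain ⟨T, e, he, hopt, hT⟩ := GCSG.exists_runs_searchP hv h0 hfg hα0 hα1 hn hC0
    (fun W hW => hp _ _ (hS.listGraph_mem hG hW)) hσ0 hσ'
  obtain ⟨y, t, hrun, ht, hP⟩ := GCSG.solvesWithin_gcsgP hv h0 he hopt
  refine ⟨y, t, hrun, ht.trans ?_, hP⟩
  have hn1 : (1 : ℝ) ≤ n := by exact_mod_cast hn
  have hlogn : 0 ≤ Real.log n := Real.log_natCast_nonneg n
  set E : ℝ := Real.exp (140 * Real.log (n + 2) + (GCSG.lastLevel α n + 2) * Real.log 13 +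
    GCSG.h f g α n) with hE
  have hE' : E = GCSG.cost 0 n 140 * 13 ^ (GCSG.lastLevel α n + 2) * Real.exp (GCSG.h f g α n) := by
    rw [hE, Real.exp_add, Real.exp_add]
    congr 2
    · rw [GCSG.cast_cost_zero, Nat.cast_ofNat]
    · rw [mul_comm, Real.exp_mul, Real.exp_log (by norm_num)]
      norm_cast
  have hexp1 : 1 ≤ Real.exp (GCSG.h f g α n) := by
    rw [GCSG.h_eq]
    refine Real.one_le_exp (Finset.sum_nonneg fun i hi => hfg.levelTerm_nonneg hα0 hα1 hn
      ((GCSG.le_lastLevel_iff hα0 hα1 hn i).1 (by have := Finset.mem_range.1 hi; omega)))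
  have h13 : (1 : ℝ) ≤ 13 ^ (GCSG.lastLevel α n + 2) := one_le_pow₀ (by norm_num)
  have hTE : ((T + GCSG.cost 0 n 140 : ℕ) : ℝ) ≤ (C + 2) * E := by
    have h2 : (GCSG.cost 0 n 134 : ℝ) ≤ GCSG.cost 0 n 140 := by
      exact_mod_cast GCSG.cost_mono 0 n (by norm_num)
    have h3 : (GCSG.cost 0 n 140 : ℝ) ≤ E := by
      rw [hE', mul_assoc]
      exact le_mul_of_one_le_right (by positivity) (one_le_mul_of_one_le_of_one_le h13 hexp1)
    have h4 : (T : ℝ) ≤ (C + 1) * E := by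
      refine hT.trans ?_
      rw [hE', mul_assoc (C + 1), mul_assoc (C + 1)]
      refine mul_le_mul_of_nonneg_left ?_ (by positivity)
      exact mul_le_mul_of_nonneg_right (mul_le_mul_of_nonneg_right h2 (by positivity))
        (Real.exp_pos _).le
    rw [Nat.cast_add]
    linarith
  refine hTE.trans ?_
  rw [mul_assoc, ← Real.exp_add]
  refine mul_le_mul_of_nonneg_left (Real.exp_le_exp.2 ?_) (by positivity)
  have h1 : Real.log ((n : ℝ) + 2) ≤ Real.log 3 + Real.log n := by
    rw [← Real.log_mul (by norm_num) (by positivity)]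
    exact Real.log_le_log (by positivity) (by linarith)
  have h2 : (GCSG.lastLevel α n : ℝ) ≤ Real.log n / |Real.log α| := Nat.floor_le (by positivity)
  have h3 : (GCSG.lastLevel α n : ℝ) * Real.log 13 ≤ Real.log 13 / |Real.log α| * Real.log n := by
    calc _ ≤ Real.log n / |Real.log α| * Real.log 13 :=
          mul_le_mul_of_nonneg_right h2 (Real.log_nonneg (by norm_num))
      _ = _ := by ring
  have h4 := hK f g hfg n hn
  rw [hc] at h4
  linarith
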